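/- Let $X$ be a scheme and let $\mathfrak p\subseteq\mathcal O_X$ be a coherent ideal, meaning a quasi-coherent sheaf of ideals of finite type. For an $\mathcal O_X$-module $\mathcal M$ write $\widehat{\mathcal M}=\varprojlim_n \mathcal M/\mathfrak p^n\mathcal M$ for its $\mathfrak p$-adic completion (limit in the category of $\mathcal O_X$-modules). Call $\mathcal M$ *affinely $\mathfrak p$-acyclic* if for every affine open $U=\operatorname{Spec}A\subseteq X$, with $I=\Gamma(U,\mathfrak p)$, and every $n\ge 0$: $H^i(U,\mathcal M)=0$ and $H^i(U,\mathcal M/\mathfrak p^n\mathcal M)=0$ for all $i>0$, and the natural map $\Gamma(U,\mathcal M)\otimes_A A/I^n\to\Gamma(U,\mathcal M/\mathfrak p^n\mathcal M)$ is an isomorphism. Let $$0\to\mathcal M\to C^0\mathcal M\to C^1\mathcal M\to\cdots$$ be the Godement resolution of $\mathcal M$: $\Gamma(U,C^0\mathcal N)=\prod_{x\in U}\mathcal N_x$ for every $\mathcal O_X$-module $\mathcal N$, and, putting $\mathcal N_0=\mathcal M$ and $\mathcal N_{i+1}=\operatorname{Coker}(\mathcal N_i\to C^0\mathcal N_i)$,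 $C^i\mathcal M=C^0\mathcal N_i$ with differential the composite $C^i\mathcal M\to\mathcal N_{i+1}\to C^{i+1}\mathcal M$. Then: 1. Every quasi-coherent $\mathcal O_X$-module is affinely $\mathfrak p$-acyclic. 2. If $\mathcal M$ is an affinely $\mathfrak p$-acyclic $\mathcal O_X$-module, then the termwise $\mathfrak p$-adic completion of its Godement resolution is a flasque resolution of $\widehat{\mathcal M}$: every $\widehat{C^i\mathcal M}$ is flasque, and $0\to\widehat{\mathcal M}\to\widehat{C^0\mathcal M}\to\widehat{C^1\mathcal M}\to\cdots$ is exact. Moreover, for every $i\ge 0$ the kernel $\mathcal M_i=\operatorname{Ker}(C^i\mathcal M\to C^{i+1}\mathcal M)$ is again affinely $\mathfrak p$-acyclic. -/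

import Mathlib

open CategoryTheory Limits TopologicalSpace Opposite AlgebraicGeometry

universe u

-- makes `⟶` elaborate to the hom-sets of the category rather than through reflexive quivers
attribute [local instance 2000] CategoryStruct.toQuiver

namespace AdicGodement

variable {X : Scheme.{u}}

/-! ### The submodule `J M` of an `𝒪_X`-module `M` -/

/-- A section `s` of `M` over `U` is a section of `J M` if every point of `U` has an affine
neighbourhood `V ⊆ U` with `s|_V ∈ J(V) · Γ(V, M)`. -/
def IsSectionOfMul (J : X.IdealSheafData) (M : X.Modules) {U : X.Opens} (s : Γ(M, U)) : Prop :=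
  ∀ x ∈ U, ∃ (V : X.affineOpens) (h : V.1 ≤ U), x ∈ V.1 ∧
    M.presheaf.map (homOfLE h).op s ∈ (J.ideal V • ⊤ : Submodule Γ(X, V.1) Γ(M, V.1))

theorem map_mem_smul_top (J : X.IdealSheafData) (M : X.Modules) {V W : X.affineOpens}
    (h : W.1 ≤ V.1) {s : Γ(M, V.1)} (hs : s ∈ (J.ideal V • ⊤ : Submodule Γ(X, V.1) Γ(M, V.1))) :
    M.presheaf.map (homOfLE h).op s ∈ (J.ideal W • ⊤ : Submodule Γ(X, W.1) Γ(M, W.1)) := by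
  induction hs using Submodule.smul_induction_on' with
  | smul r hr m _ =>
    rw [Scheme.Modules.map_smul]
    exact Submodule.smul_mem_smul (J.ideal_le_comap_ideal (show W ≤ V from h) hr) trivial
  | add a _ b _ ha hb =>
    rw [map_add]
    exact add_mem ha hb

theorem map_map_apply (M : X.Modules) {U V W : X.Opens} (h : V ≤ U) (h' : W ≤ V) (s : Γ(M, U)) :
    M.presheaf.map (homOfLE h').op (M.presheaf.map (homOfLE h).op s) =
      M.presheaf.map (homOfLE (h'.trans h)).op s := by
  rw [← ConcreteCategory.comp_apply, ← Functor.map_comp]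
  rfl

theorem IsSectionOfMul.refine {J : X.IdealSheafData} {M : X.Modules} {U : X.Opens} {s : Γ(M, U)}
    (hs : IsSectionOfMul J M s) {W : X.Opens} (hW : W ≤ U) {x : X} (hx : x ∈ W) :
    ∃ (V : X.affineOpens) (h : V.1 ≤ U), V.1 ≤ W ∧ x ∈ V.1 ∧
      M.presheaf.map (homOfLE h).op s ∈ (J.ideal V • ⊤ : Submodule Γ(X, V.1) Γ(M, V.1)) := by
  obtain ⟨V, h, hxV, hV⟩ := hs x (hW hx)
  obtain ⟨V', hV', hxV', hle⟩ := X.isBasis_affineOpens.exists_subset_of_mem_open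
    (show x ∈ ((V.1 ⊓ W : X.Opens) : Set X) from ⟨hxV, hx⟩) (V.1 ⊓ W).isOpen
  obtain ⟨V'', hV'', rfl⟩ := hV'
  have h1 : V'' ≤ V.1 := fun _ hy => (hle hy).1
  have h2 : V'' ≤ W := fun _ hy => (hle hy).2
  refine ⟨⟨V'', hV''⟩, h1.trans h, h2, hxV', ?_⟩
  rw [← map_map_apply M h h1]
  exact map_mem_smul_top J M (W := ⟨V'', hV''⟩) h1 hV

theorem IsSectionOfMul.add {J : X.IdealSheafData} {M : X.Modules} {U : X.Opens} {s t : Γ(M, U)}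
    (hs : IsSectionOfMul J M s) (ht : IsSectionOfMul J M t) : IsSectionOfMul J M (s + t) := by
  intro x hx
  obtain ⟨V, h, hxV, hV⟩ := hs x hx
  obtain ⟨V', h', hle, hxV', hV'⟩ := ht.refine h hxV
  refine ⟨V', h', hxV', ?_⟩
  rw [map_add]
  refine add_mem ?_ hV'
  rw [← map_map_apply M h hle]
  exact map_mem_smul_top J M hle hV

theorem IsSectionOfMul.zero (J : X.IdealSheafData) (M : X.Modules) (U : X.Opens) :
    IsSectionOfMul J M (0 : Γ(M, U)) := by
  intro x hx
  obtain ⟨V, hV, hxV, hle⟩ := X.isBasis_affineOpens.exists_subset_of_mem_open hx U.isOpen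
  obtain ⟨V', hV', rfl⟩ := hV
  refine ⟨⟨V', hV'⟩, hle, hxV, ?_⟩
  rw [map_zero]
  exact zero_mem _

theorem IsSectionOfMul.smul {J : X.IdealSheafData} {M : X.Modules} {U : X.Opens} {s : Γ(M, U)}
    (r : Γ(X, U)) (hs : IsSectionOfMul J M s) : IsSectionOfMul J M (r • s) := by
  intro x hx
  obtain ⟨V, h, hxV, hV⟩ := hs x hx
  refine ⟨V, h, hxV, ?_⟩
  rw [Scheme.Modules.map_smul]
  exact Submodule.smul_mem _ _ hV

theorem IsSectionOfMul.map {J : X.IdealSheafData} {M : X.Modules} {U W : X.Opens} {s : Γ(M, U)}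
    (hs : IsSectionOfMul J M s) (hW : W ≤ U) :
    IsSectionOfMul J M (M.presheaf.map (homOfLE hW).op s) := by
  intro x hx
  obtain ⟨V, h, hle, hxV, hV⟩ := hs.refine hW hx
  refine ⟨V, hle, hxV, ?_⟩
  rwa [map_map_apply]

theorem IsSectionOfMul.hom {J : X.IdealSheafData} {M N : X.Modules} (f : M ⟶ N) {U : X.Opens}
    {s : Γ(M, U)} (hs : IsSectionOfMul J M s) : IsSectionOfMul J N (f.app U s) := by
  intro x hx
  obtain ⟨V, h, hxV, hV⟩ := hs x hx
  refine ⟨V, h, hxV, ?_⟩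
  have key : N.presheaf.map (homOfLE h).op (f.app U s) =
      f.app V.1 (M.presheaf.map (homOfLE h).op s) :=
    (CategoryTheory.congr_fun (f.mapPresheaf.naturality (homOfLE h).op) s).symm
  rw [key]
  generalize M.presheaf.map (homOfLE h).op s = t at hV
  induction hV using Submodule.smul_induction_on' with
  | smul r hr m _ =>
    rw [Scheme.Modules.Hom.app_smul]
    exact Submodule.smul_mem_smul hr trivial
  | add a _ b _ ha hb =>
    rw [map_add]
    exact add_mem ha hb

theorem IsSectionOfMul.mono {J J' : X.IdealSheafData} (hJ : J ≤ J') {M : X.Modules} {U : X.Opens}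
    {s : Γ(M, U)} (hs : IsSectionOfMul J M s) : IsSectionOfMul J' M s := by
  intro x hx
  obtain ⟨V, h, hxV, hV⟩ := hs x hx
  exact ⟨V, h, hxV, Submodule.smul_mono_left (hJ V) hV⟩

/-- The presheaf of modules underlying `J M`. -/
noncomputable def mulSubmodule (J : X.IdealSheafData) (M : X.Modules) : M.val.Submodule where
  obj U :=
    { carrier := {s | IsSectionOfMul J M (U := U.unop) s}
      add_mem' := fun hs ht => IsSectionOfMul.add hs ht
      zero_mem' := IsSectionOfMul.zero J M U.unop
      smul_mem' := fun r _ hs => IsSectionOfMul.smul r hs }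
  map f := fun s hs => IsSectionOfMul.map (s := s) hs (leOfHom f.unop)

theorem mulSubmodule_isSheaf (J : X.IdealSheafData) (M : X.Modules) :
    TopCat.Presheaf.IsSheaf (X := X.toPresheafedSpace)
      (mulSubmodule J M).toPresheafOfModules.presheaf := by
  rw [TopCat.Presheaf.isSheaf_iff_isSheafUniqueGluing]
  intro ι U sf hsf
  obtain ⟨s, hs, huniq⟩ := TopCat.Presheaf.IsSheaf.isSheafUniqueGluing
    (F := M.presheaf) M.isSheaf U
    (fun i => show Γ(M, U i) from (sf i).1) (fun i j => congrArg Subtype.val (hsf i j))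
  refine ⟨⟨s, ?_⟩, fun i => Subtype.ext (hs i), fun t ht => Subtype.ext
    (huniq t.1 fun i => congrArg Subtype.val (ht i))⟩
  intro x hx
  obtain ⟨i, hxi⟩ := Opens.mem_iSup.mp hx
  obtain ⟨V, h, hxV, hV⟩ := (sf i).2 x hxi
  refine ⟨V, h.trans (le_iSup U i), hxV, ?_⟩
  rw [← map_map_apply M (le_iSup U i) h]
  have key : M.presheaf.map (homOfLE (le_iSup U i)).op s = (sf i).1 := hs i
  rw [key]
  exact hV

/-- The sheaf of modules `J M`. -/
noncomputable def mul (J : X.IdealSheafData) (M : X.Modules) : X.Modules :=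
  ⟨(mulSubmodule J M).toPresheafOfModules, mulSubmodule_isSheaf J M⟩

/-- The inclusion `J M ⟶ M`. -/
noncomputable def mulι (J : X.IdealSheafData) (M : X.Modules) : mul J M ⟶ M :=
  ⟨(mulSubmodule J M).ι⟩

/-- The morphism `J M ⟶ J' N` induced by `f : M ⟶ N`, for `J ⊆ J'`. -/
noncomputable def mulMap {J J' : X.IdealSheafData} (h : J ≤ J') {M N : X.Modules} (f : M ⟶ N) :
    mul J M ⟶ mul J' N :=
  ⟨PresheafOfModules.homMk
    { app := fun U => AddCommGrpCat.ofHom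
        (AddMonoidHom.mk' (fun s => ⟨f.app U.unop s.1, (IsSectionOfMul.hom f s.2).mono h⟩)
          (fun s t => Subtype.ext (map_add (f.app U.unop).hom s.1 t.1)))
      naturality := fun U V i => by
        ext s
        exact Subtype.ext (CategoryTheory.congr_fun (f.mapPresheaf.naturality i)
          (show Γ(M, U.unop) from s.1)) }
    (fun U r s => Subtype.ext (Scheme.Modules.Hom.app_smul (U := U.unop) (φ := f) r s.1))⟩

theorem mulMap_ι {J J' : X.IdealSheafData} (h : J ≤ J') {M N : X.Modules} (f : M ⟶ N) :
    mulMap h f ≫ mulι J' N = mulι J M ≫ f := rfl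

/-! ### The quotient `M / J M` and the adic completion -/

/-- The quotient `M / J M`. -/
noncomputable def quot (J : X.IdealSheafData) (M : X.Modules) : X.Modules :=
  cokernel (mulι J M)

/-- The projection `M ⟶ M / J M`. -/
noncomputable def quotπ (J : X.IdealSheafData) (M : X.Modules) : M ⟶ quot J M :=
  cokernel.π (mulι J M)

instance (J : X.IdealSheafData) (M : X.Modules) : Epi (quotπ J M) :=
  inferInstanceAs (Epi (cokernel.π (mulι J M)))

theorem mulι_quotπ (J : X.IdealSheafData) (M : X.Modules) : mulι J M ≫ quotπ J M = 0 :=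
  cokernel.condition _

/-- The morphism `M / J M ⟶ N / J' N` induced by `f : M ⟶ N`, for `J ⊆ J'`. -/
noncomputable def quotMap {J J' : X.IdealSheafData} (h : J ≤ J') {M N : X.Modules} (f : M ⟶ N) :
    quot J M ⟶ quot J' N :=
  cokernel.desc _ (f ≫ quotπ J' N) (by
    rw [← Category.assoc, ← mulMap_ι h f, Category.assoc, mulι_quotπ, comp_zero])

@[simp]
theorem quotπ_quotMap {J J' : X.IdealSheafData} (h : J ≤ J') {M N : X.Modules} (f : M ⟶ N) :
    quotπ J M ≫ quotMap h f = f ≫ quotπ J' N :=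
  cokernel.π_desc _ _ _

theorem quotMap_id (J : X.IdealSheafData) (M : X.Modules) :
    quotMap (le_refl J) (𝟙 M) = 𝟙 (quot J M) := by
  rw [← cancel_epi (quotπ J M), quotπ_quotMap, Category.id_comp, Category.comp_id]

theorem quotMap_comp {J J' J'' : X.IdealSheafData} (h : J ≤ J') (h' : J' ≤ J'')
    {M N P : X.Modules} (f : M ⟶ N) (g : N ⟶ P) :
    quotMap h f ≫ quotMap h' g = quotMap (h.trans h') (f ≫ g) := by
  rw [← cancel_epi (quotπ J M), ← Category.assoc, quotπ_quotMap, quotπ_quotMap, Category.assoc,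
    quotπ_quotMap, Category.assoc]

theorem quotMap_zero {J J' : X.IdealSheafData} (h : J ≤ J') (M N : X.Modules) :
    quotMap h (0 : M ⟶ N) = 0 := by
  rw [← cancel_epi (quotπ J M), quotπ_quotMap, zero_comp, comp_zero]

theorem pow_le_pow_ideal (p : X.IdealSheafData) {m n : ℕ} (h : n ≤ m) : p ^ m ≤ p ^ n := by
  intro U
  simp only [Scheme.IdealSheafData.ideal_pow, Pi.pow_apply]
  exact Ideal.pow_le_pow_right h

/-- The inverse system `⋯ ⟶ M / p² M ⟶ M / p M ⟶ M / p⁰ M`, functorially in `M`. -/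
noncomputable def adicTower (p : X.IdealSheafData) : X.Modules ⥤ ℕᵒᵖ ⥤ X.Modules where
  obj M :=
    { obj := fun n => quot (p ^ n.unop) M
      map := fun i => quotMap (pow_le_pow_ideal p (leOfHom i.unop)) (𝟙 M)
      map_id := fun n => quotMap_id _ _
      map_comp := fun i j => by
        simp only [quotMap_comp, Category.comp_id] }
  map f :=
    { app := fun n => quotMap le_rfl f
      naturality := fun m n i => by
        simp only [quotMap_comp, Category.comp_id, Category.id_comp] }
  map_id M := by
    ext n : 2
    exact quotMap_id _ _
  map_comp f g := by
    ext n : 2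
    rw [NatTrans.comp_app]
    exact (quotMap_comp (le_refl (p ^ n.unop)) (le_refl (p ^ n.unop)) f g).symm

/-- The `p`-adic completion functor `M ↦ lim_n M / pⁿ M` on `𝒪_X`-modules. -/
noncomputable def completion (p : X.IdealSheafData) : X.Modules ⥤ X.Modules :=
  adicTower p ⋙ lim

instance (p : X.IdealSheafData) : (completion p).PreservesZeroMorphisms where
  map_zero M N := by
    have : (adicTower p).map (0 : M ⟶ N) = 0 := by
      ext n : 2
      exact quotMap_zero (le_refl (p ^ n.unop)) _ _
    rw [completion, Functor.comp_map, this, Functor.map_zero]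

/-! ### The Godement resolution -/

/-- The stalk `M_x`. -/
noncomputable abbrev stalk (M : X.Modules) (x : X) : Ab.{u} := M.presheaf.stalk x

/-- The `𝒪_{X,x}`-module structure of the stalk `M_x`. -/
noncomputable instance stalkModule (M : X.Modules) (x : X) :
    Module (X.presheaf.stalk x) (stalk M x) :=
  PresheafOfModules.instModuleCarrierStalkCommRingCatCarrierAbPresheafOpensCarrier
    (R := X.presheaf) M.val x

theorem germ_smul (M : X.Modules) (U : X.Opens) (x : X) (hx : x ∈ U) (r : Γ(X, U)) (s : Γ(M, U)) :
    (M.presheaf.germ U x hx (r • s) : stalk M x) =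
      X.presheaf.germ U x hx r • (M.presheaf.germ U x hx s : stalk M x) :=
  PresheafOfModules.germ_smul (R := X.presheaf) M.val x U hx r s

/-- The abelian presheaf `U ↦ ∏_{x ∈ U} M_x`. -/
noncomputable def godementPresheaf (M : X.Modules) : TopCat.Presheaf Ab.{u} X where
  obj U := AddCommGrpCat.of (∀ x : U.unop, stalk M x.1)
  map i := AddCommGrpCat.ofHom
    (AddMonoidHom.mk' (fun s x => s ⟨x.1, leOfHom i.unop x.2⟩) (fun _ _ => rfl))

/-- `Γ(U, 𝒪_X)` acts on `∏_{x ∈ U} M_x` through the germs. -/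
noncomputable instance godementModule (M : X.Modules) (U : X.Opensᵒᵖ) :
    Module (X.ringCatSheaf.obj.obj U) ((godementPresheaf M).obj U) :=
  letI (x : U.unop) : Module Γ(X, U.unop) (stalk M x.1) :=
    Module.compHom _ (X.presheaf.germ U.unop x.1 x.2).hom
  inferInstanceAs (Module Γ(X, U.unop) (∀ x : U.unop, stalk M x.1))

theorem godement_smul_apply (M : X.Modules) (U : X.Opens) (r : Γ(X, U))
    (s : (godementPresheaf M).obj (op U)) (x : U) :
    (show ∀ x : U, stalk M x.1 from
      (show X.ringCatSheaf.obj.obj (op U) from r) • s) x =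
      X.presheaf.germ U x.1 x.2 r • (show ∀ x : U, stalk M x.1 from s) x := rfl

theorem godementPresheaf_isSheaf (M : X.Modules) : (godementPresheaf M).IsSheaf := by
  rw [TopCat.Presheaf.isSheaf_iff_isSheafUniqueGluing]
  intro ι U sf hsf
  have hsf' : ∀ (i j : ι) (x : X) (hi : x ∈ U i) (hj : x ∈ U j),
      (show ∀ x : (U i), stalk M x.1 from sf i) ⟨x, hi⟩ =
        (show ∀ x : (U j), stalk M x.1 from sf j) ⟨x, hj⟩ := fun i j x hi hj =>
    congrFun (hsf i j) ⟨x, hi, hj⟩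
  choose k hk using fun x : (iSup U : Opens X) => Opens.mem_iSup.mp x.2
  refine ⟨fun x => (show ∀ y : (U (k x)), stalk M y.1 from sf (k x)) ⟨x.1, hk x⟩, fun i => ?_,
    fun t ht => ?_⟩
  · funext x
    exact hsf' _ _ _ _ _
  · funext x
    exact congrFun (ht (k x)) ⟨x.1, hk x⟩

/-- The sheaf `C⁰ M` of discontinuous sections: `Γ(U, C⁰ M) = ∏_{x ∈ U} M_x`. -/
noncomputable def godement₀ (M : X.Modules) : X.Modules :=
  ⟨PresheafOfModules.ofPresheaf (godementPresheaf M) (fun {U V} i r s => by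
      funext x
      exact congrArg
        (fun a : X.presheaf.stalk x.1 => a • (s ⟨x.1, leOfHom i.unop x.2⟩ : stalk M x.1))
        (TopCat.Presheaf.germ_res_apply' X.presheaf i x.1 x.2 r).symm),
    godementPresheaf_isSheaf M⟩

/-- The canonical morphism `M ⟶ C⁰ M`, sending a section to the family of its germs. -/
noncomputable def toGodement₀ (M : X.Modules) : M ⟶ godement₀ M :=
  ⟨PresheafOfModules.homMk
    { app := fun U => AddCommGrpCat.ofHom
        (AddMonoidHom.mk' (fun s x => M.presheaf.germ U.unop x.1 x.2 s) (fun s t => by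
          funext x
          exact map_add (M.presheaf.germ U.unop x.1 x.2).hom s t))
      naturality := fun U V i => by
        ext s
        funext x
        exact TopCat.Presheaf.germ_res_apply' M.presheaf i x.1 x.2 s }
    (fun U r s => by
      funext x
      exact germ_smul M U.unop x.1 x.2 r s)⟩

/-- The successive cokernels in the Godement resolution: `M_0 = M` and
`M_{i+1} = Coker (M_i ⟶ C⁰ M_i)`. -/
noncomputable def godementCosyzygy (M : X.Modules) : ℕ → X.Modules
  | 0 => M
  | i + 1 => cokernel (toGodement₀ (godementCosyzygy M i))

/-- The projection `C^i M = C⁰ M_i ⟶ M_{i+1}`. -/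
noncomputable def godementπ (M : X.Modules) (i : ℕ) :
    godement₀ (godementCosyzygy M i) ⟶ godementCosyzygy M (i + 1) :=
  cokernel.π (toGodement₀ (godementCosyzygy M i))

theorem toGodement₀_godementπ (M : X.Modules) (i : ℕ) :
    toGodement₀ (godementCosyzygy M i) ≫ godementπ M i = 0 :=
  cokernel.condition _

/-- The differential `C^i M = C⁰ M_i ⟶ M_{i+1} ⟶ C⁰ M_{i+1} = C^{i+1} M`. -/
noncomputable def godementD (M : X.Modules) (i : ℕ) :
    godement₀ (godementCosyzygy M i) ⟶ godement₀ (godementCosyzygy M (i + 1)) :=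
  godementπ M i ≫ toGodement₀ (godementCosyzygy M (i + 1))

theorem toGodement₀_godementD (M : X.Modules) (i : ℕ) :
    toGodement₀ (godementCosyzygy M i) ≫ godementD M i = 0 := by
  rw [godementD, ← Category.assoc, toGodement₀_godementπ, zero_comp]

/-- The Godement complex `C⁰ M ⟶ C¹ M ⟶ C² M ⟶ ⋯`. -/
noncomputable def godementComplex (M : X.Modules) : CochainComplex X.Modules ℕ :=
  CochainComplex.of (fun i => godement₀ (godementCosyzygy M i)) (godementD M) (fun i => by
    rw [godementD, Category.assoc, toGodement₀_godementD M (i + 1), comp_zero])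

theorem godementComplex_d (M : X.Modules) (i : ℕ) :
    (godementComplex M).d i (i + 1) = godementD M i :=
  CochainComplex.of_d (fun i => godement₀ (godementCosyzygy M i)) (godementD M) i

/-- The augmentation `M ⟶ C^• M`. -/
noncomputable def godementAugmentation (M : X.Modules) :
    (CochainComplex.single₀ X.Modules).obj M ⟶ godementComplex M :=
  (CochainComplex.fromSingle₀Equiv (godementComplex M) M).symm ⟨toGodement₀ M, by
    rw [godementComplex_d M 0]
    exact toGodement₀_godementD M 0⟩

/-! ### Completing the Godement resolution -/

/-- The complex obtained by completing each term of the Godement complex `C^• M`. -/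
noncomputable def completedGodementComplex (p : X.IdealSheafData) (M : X.Modules) :
    CochainComplex X.Modules ℕ :=
  ((completion p).mapHomologicalComplex (ComplexShape.up ℕ)).obj (godementComplex M)

/-- The completion of the augmentation `M ⟶ C^• M`. -/
noncomputable def completedGodementAugmentation (p : X.IdealSheafData) (M : X.Modules) :
    (CochainComplex.single₀ X.Modules).obj ((completion p).obj M) ⟶
      completedGodementComplex p M :=
  (HomologicalComplex.singleMapHomologicalComplex (completion p) (ComplexShape.up ℕ) 0).inv.app M ≫
    ((completion p).mapHomologicalComplex (ComplexShape.up ℕ)).map (godementAugmentation M)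

/-- `ε : N ⟶ K` exhibits the complex `K` (in degrees `≥ 0`) as a flasque resolution of `N`: the
terms `K^i` are flasque sheaves, and `0 ⟶ N ⟶ K⁰ ⟶ K¹ ⟶ ⋯` is exact. -/
structure IsFlasqueResolution {N : X.Modules} {K : CochainComplex X.Modules ℕ}
    (ε : (CochainComplex.single₀ X.Modules).obj N ⟶ K) : Prop where
  flasque : ∀ i, TopCat.Presheaf.IsFlasque (K.X i).presheaf
  quasiIso : QuasiIso ε

/-! ### Affinely `p`-acyclic modules -/

/-- `M` is acyclic on `U`: the sheaf cohomology `H^i(U, M)` vanishes for all `i > 0`. -/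
def IsAcyclicOn (M : X.Modules) (U : X.Opens) : Prop :=
  ∀ i : ℕ, 0 < i →
    Subsingleton (Sheaf.H' ((SheafOfModules.toSheaf X.ringCatSheaf).obj M) i U)

/-- A morphism of `𝒪_X`-modules on sections over `U`, as a `Γ(U, 𝒪_X)`-linear map. -/
noncomputable def sectionsMap {M N : X.Modules} (f : M ⟶ N) (U : X.Opens) :
    Γ(M, U) →ₗ[Γ(X, U)] Γ(N, U) where
  toFun := f.app U
  map_add' := map_add (f.app U).hom
  map_smul' := Scheme.Modules.Hom.app_smul f

theorem smul_top_le_ker_quotπ (J : X.IdealSheafData) (M : X.Modules) (U : X.affineOpens) :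
    (J.ideal U • ⊤ : Submodule Γ(X, U.1) Γ(M, U.1)) ≤
      LinearMap.ker (sectionsMap (quotπ J M) U.1) := by
  intro s hs
  have hs' : IsSectionOfMul J M s := fun x hx => ⟨U, le_rfl, hx, by
    have : M.presheaf.map (homOfLE (le_refl U.1)).op s = s :=
      CategoryTheory.congr_fun (M.presheaf.map_id (op U.1)) s
    rwa [this]⟩
  exact congrArg (fun f : mul J M ⟶ quot J M => f.app U.1 (show Γ(mul J M, U.1) from ⟨s, hs'⟩))
    (mulι_quotπ J M)

/-- The natural map `Γ(U, M) ⊗_A A / Iⁿ ⟶ Γ(U, M / pⁿ M)`, `m ⊗ a ↦ a m`, for an affine open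
`U = Spec A` and `I = p(U)`. -/
noncomputable def tensorToSections (p : X.IdealSheafData) (n : ℕ) (M : X.Modules)
    (U : X.affineOpens) :
    TensorProduct Γ(X, U.1) Γ(M, U.1) (Γ(X, U.1) ⧸ p.ideal U ^ n) →ₗ[Γ(X, U.1)]
      Γ(quot (p ^ n) M, U.1) :=
  (Submodule.liftQ (p.ideal U ^ n • ⊤) (sectionsMap (quotπ (p ^ n) M) U.1)
    (smul_top_le_ker_quotπ (p ^ n) M U)) ∘ₗ
  (TensorProduct.tensorQuotEquivQuotSMul Γ(M, U.1) (p.ideal U ^ n)).toLinearMap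

theorem tensorToSections_tmul (p : X.IdealSheafData) (n : ℕ) (M : X.Modules)
    (U : X.affineOpens) (m : Γ(M, U.1)) (a : Γ(X, U.1)) :
    tensorToSections p n M U (TensorProduct.tmul _ m (Ideal.Quotient.mk (p.ideal U ^ n) a)) =
      a • (quotπ (p ^ n) M).app U.1 m := by
  rw [tensorToSections, LinearMap.comp_apply, LinearEquiv.coe_coe,
    TensorProduct.tensorQuotEquivQuotSMul_tmul_mk]
  exact map_smul (sectionsMap (quotπ (p ^ n) M) U.1) a m

/-- `M` is affinely `p`-acyclic: for every affine open `U` and every `n`, the sheaves `M` and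
`M / pⁿ M` are acyclic on `U`, and `Γ(U, M) ⊗_A A / p(U)ⁿ ⟶ Γ(U, M / pⁿ M)` is bijective. -/
def IsAffinelyAcyclic (p : X.IdealSheafData) (M : X.Modules) : Prop :=
  ∀ (U : X.affineOpens) (n : ℕ),
    IsAcyclicOn M U.1 ∧ IsAcyclicOn (quot (p ^ n) M) U.1 ∧
      Function.Bijective (tensorToSections p n M U)

end AdicGodement

/-!
Two mechanisms are at work: one shows that quasi-coherent modules are affinely acyclic, the other
that completion preserves the exactness of the Godement sequences.

*Quasi-coherent modules.* Let `M` be quasi-coherent. Over an affine open set `U`, its sections over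
`D(f)` are the localization `Γ(U, M)_f` (`hasLocalizedSections_of_isQuasicoherent`). It follows that
`J M` has the same property and that `Γ(U, J M) = J(U) Γ(U, M)`: for a section `s` of `J M`, the
functions `f` with `f s ∈ J(U) Γ(U, M)` form an ideal whose radical is the unit ideal
(`HasLocalizedSections.mem_smul_top`). Clearing denominators against a relation `u fⁿ + v gⁿ = 1`
shows that the first Čech cohomology of such a module vanishes for the coverings of affine open sets
by two basic open sets `D(f)`, `D(g)` with `f + g = 1` (`HasLocalizedSections.hasSplitSections`).
For an abelian sheaf `F₁` with the latter property and a short exact sequence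
`0 ⟶ F₁ ⟶ F₂ ⟶ F₃ ⟶ 0`, the functions `f` such that a given section of `F₃` over an affine open set
lifts over `D(f)` form an ideal, and it is the unit ideal because sections lift locally
(`HasSplitSections.app_surjective`). So sections over affine open sets lift, the property passes to
quotients, and embedding into injective sheaves gives the vanishing of cohomology in all positive
degrees by dimension shifting (`isAcyclic_of_forall_shortExact`). All this applies to `J M`, to `M`,
and to the quotient `M / J M`, for `J = pⁿ`.

*The Godement resolution.* For an ideal `I` generated by finitely many elements, one has
`I ∏ M_x = ∏ I M_x`. Hence a discontinuous section belongs to `J C⁰ M` if and only if its value at each point `x` belongs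
to `J_x M_x` (`isSectionOfMul_godement₀_iff`). So `C⁰ M / J C⁰ M` and the completion of `C⁰ M` are
flasque, by extension by zero, and `M / J M ⟶ C⁰ M / J C⁰ M` remains injective. Let
`Q = Coker (M ⟶ C⁰ M)`. The sequences `0 ⟶ M / pⁿ M ⟶ C⁰ M / pⁿ C⁰ M ⟶ Q / pⁿ Q ⟶ 0` are then
exact, and the long exact sequences of cohomology show that `Q` is affinely `p`-acyclic if `M` is
(`isAffinelyAcyclic_godementCosyzygy` iterates this). Over an affine open set these sequences stay
exact on sections, and the transition maps of the system `Γ(U, M / pⁿ M)` are surjective since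
sections of `M / pⁿ M` lift to `M`; by the Mittag-Leffler argument, the limit over `n` is exact
(`completion_godementShortComplex_shortExact`). The completed resolution is the splice of these
short exact sequences for the successive cokernels.
-/

/-! ### Cohomology of abelian sheaves on a topological space -/

namespace AdicGodement.AbSheaf

open Abelian

variable {X : TopCat.{u}}

/-- The free abelian sheaf on the open set `U`. -/
noncomputable abbrev freeSheaf (U : Opens X) : Sheaf (Opens.grothendieckTopology X) Ab.{u} :=
  (presheafToSheaf (Opens.grothendieckTopology X) Ab.{u}).obj
    (((Functor.whiskeringRight _ _ _).obj AddCommGrpCat.free).obj (yoneda.obj U))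

/-- Morphisms from the free abelian sheaf on `U` to `F` are the sections of `F` over `U`. -/
noncomputable def homFreeSheafEquiv (U : Opens X)
    (F : Sheaf (Opens.grothendieckTopology X) Ab.{u}) :
    (freeSheaf U ⟶ F) ≃ F.obj.obj (op U) :=
  ((sheafificationAdjunction _ _).homEquiv _ _).trans
    (((AddCommGrpCat.adj.whiskerRight _).homEquiv _ _).trans yonedaEquiv)

theorem homFreeSheafEquiv_comp (U : Opens X) {F G : Sheaf (Opens.grothendieckTopology X) Ab.{u}}
    (g : F ⟶ G) (a : freeSheaf U ⟶ F) :
    homFreeSheafEquiv U G (a ≫ g) = g.hom.app (op U) (homFreeSheafEquiv U F a) := by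
  dsimp only [homFreeSheafEquiv]
  rw [Equiv.trans_apply, Equiv.trans_apply, Equiv.trans_apply, Equiv.trans_apply]
  rw [Adjunction.homEquiv_naturality_right, Adjunction.homEquiv_naturality_right]
  rfl

theorem homFreeSheafEquiv_map {U V : Opens X} (i : V ⟶ U)
    (F : Sheaf (Opens.grothendieckTopology X) Ab.{u}) (a : freeSheaf U ⟶ F) :
    homFreeSheafEquiv V F ((presheafToSheaf (Opens.grothendieckTopology X) Ab.{u}).map
      (((Functor.whiskeringRight _ _ _).obj AddCommGrpCat.free).map (yoneda.map i)) ≫ a) =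
      F.obj.map i.op (homFreeSheafEquiv U F a) := by
  dsimp only [homFreeSheafEquiv]
  rw [Equiv.trans_apply, Equiv.trans_apply, Equiv.trans_apply, Equiv.trans_apply]
  rw [Adjunction.homEquiv_naturality_left]
  erw [Adjunction.homEquiv_naturality_left]
  exact (yonedaEquiv_naturality _ _).symm

theorem isFlasque_of_injective (I : Sheaf (Opens.grothendieckTopology X) Ab.{u}) [Injective I] :
    TopCat.Sheaf.IsFlasque I where
  epi {U V} i := by
    rw [AddCommGrpCat.epi_iff_surjective]
    intro s
    let m : yoneda.obj V.unop ⟶ yoneda.obj U.unop := yoneda.map i.unop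
    let m' : freeSheaf V.unop ⟶ freeSheaf U.unop :=
      (presheafToSheaf (Opens.grothendieckTopology X) Ab.{u}).map
        (((Functor.whiskeringRight _ _ _).obj AddCommGrpCat.free).map m)
    have : Mono m := inferInstanceAs (Mono (yoneda.map i.unop))
    have : Mono m' := inferInstance
    refine ⟨homFreeSheafEquiv U.unop I
      (Injective.factorThru ((homFreeSheafEquiv V.unop I).symm s) m'), ?_⟩
    have h := homFreeSheafEquiv_map i.unop I
      (Injective.factorThru ((homFreeSheafEquiv V.unop I).symm s) m')
    exact h.symm.trans (by
      rw [show (presheafToSheaf (Opens.grothendieckTopology X) Ab.{u}).map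
        (((Functor.whiskeringRight _ _ _).obj AddCommGrpCat.free).map (yoneda.map i.unop)) = m'
        from rfl, Injective.comp_factorThru, Equiv.apply_symm_apply])

/-- The abelian sheaf `F` has no cohomology over `U` in positive degrees. -/
def IsAcyclic (F : Sheaf (Opens.grothendieckTopology X) Ab.{u}) (U : Opens X) : Prop :=
  ∀ i : ℕ, 0 < i → Subsingleton (Sheaf.H' F i U)

section ShortExact

variable {S : ShortComplex (Sheaf (Opens.grothendieckTopology X) Ab.{u})} (hS : S.ShortExact)
  (U : Opens X)
include hS

theorem sections_surjective_of_isAcyclic (h : IsAcyclic S.X₁ U) :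
    Function.Surjective (S.g.hom.app (op U)) := by
  intro s
  have := h 1 one_pos
  obtain ⟨x, hx⟩ := Ext.covariant_sequence_exact₃ (X := freeSheaf U) hS
    (Ext.mk₀ ((homFreeSheafEquiv U S.X₃).symm s)) (zero_add 1) (this.elim _ _)
  obtain ⟨a, rfl⟩ := Ext.addEquiv₀.symm.surjective x
  refine ⟨homFreeSheafEquiv U S.X₂ a, ?_⟩
  rw [← homFreeSheafEquiv_comp, ← Equiv.eq_symm_apply]
  apply (Ext.mk₀_bijective _ _).1
  rw [← hx, ← Ext.mk₀_comp_mk₀]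
  rfl

theorem isAcyclic_X₃ (h₁ : IsAcyclic S.X₁ U) (h₂ : IsAcyclic S.X₂ U) : IsAcyclic S.X₃ U := by
  intro i hi
  have := h₁ (i + 1) i.succ_pos
  have := h₂ i hi
  refine subsingleton_of_forall_eq 0 fun x => ?_
  obtain ⟨y, rfl⟩ := Ext.covariant_sequence_exact₃ (X := freeSheaf U) hS x rfl
    (Subsingleton.elim (α := Sheaf.H' S.X₁ (i + 1) U) _ _)
  rw [show y = 0 from Subsingleton.elim (α := Sheaf.H' S.X₂ i U) _ _]
  exact Ext.zero_comp _ _ _ _ _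

theorem subsingleton_H'_one (hg : Function.Surjective (S.g.hom.app (op U)))
    (h₂ : Subsingleton (Sheaf.H' S.X₂ 1 U)) : Subsingleton (Sheaf.H' S.X₁ 1 U) := by
  refine subsingleton_of_forall_eq 0 fun x => ?_
  obtain ⟨y, rfl⟩ := Ext.covariant_sequence_exact₁ (X := freeSheaf U) hS x
    (h₂.elim _ _) (zero_add 1)
  obtain ⟨a, rfl⟩ := Ext.addEquiv₀.symm.surjective y
  obtain ⟨t, ht⟩ := hg (homFreeSheafEquiv U S.X₃ a)
  have : a = (homFreeSheafEquiv U S.X₂).symm t ≫ S.g := by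
    apply (homFreeSheafEquiv U S.X₃).injective
    rw [homFreeSheafEquiv_comp, Equiv.apply_symm_apply, ht]
  rw [this]
  change (Ext.mk₀ _).comp _ _ = 0
  rw [← Ext.mk₀_comp_mk₀, Ext.comp_assoc_of_second_deg_zero, hS.comp_extClass, Ext.comp_zero]

theorem subsingleton_H'_succ {i : ℕ} (h₃ : Subsingleton (Sheaf.H' S.X₃ i U))
    (h₂ : Subsingleton (Sheaf.H' S.X₂ (i + 1) U)) : Subsingleton (Sheaf.H' S.X₁ (i + 1) U) := by
  refine subsingleton_of_forall_eq 0 fun x => ?_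
  obtain ⟨y, rfl⟩ := Ext.covariant_sequence_exact₁ (X := freeSheaf U) hS x
    (h₂.elim _ _) rfl
  rw [show y = 0 from Subsingleton.elim (α := Sheaf.H' S.X₃ i U) _ _]
  exact Ext.zero_comp _ _ _ _ _

end ShortExact

/-- Dimension shifting along an embedding into an injective sheaf: a class `P` of sheaves is acyclic
on the members of a family `𝓑` of open sets as soon as, for every embedding of a member `F` of `P`
into a flasque sheaf, the cokernel belongs to `P` and its sections over members of `𝓑` lift. -/
theorem isAcyclic_of_forall_shortExact
    (P : Sheaf (Opens.grothendieckTopology X) Ab.{u} → Prop) (𝓑 : Opens X → Prop)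
    (hP : ∀ (S : ShortComplex (Sheaf (Opens.grothendieckTopology X) Ab.{u})), S.ShortExact →
      TopCat.Sheaf.IsFlasque S.X₂ → P S.X₁ →
      P S.X₃ ∧ ∀ U, 𝓑 U → Function.Surjective (S.g.hom.app (op U)))
    {F : Sheaf (Opens.grothendieckTopology X) Ab.{u}} (hF : P F) {U : Opens X} (hU : 𝓑 U) :
    IsAcyclic F U := by
  intro i hi
  obtain ⟨i, rfl⟩ : ∃ j, i = j + 1 := ⟨i - 1, by omega⟩
  clear hi
  induction i generalizing F with
  | zero =>
    let S := ShortComplex.mk (Injective.ι F) (cokernel.π (Injective.ι F)) (cokernel.condition _)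
    have hS : S.ShortExact := { exact := ShortComplex.exact_cokernel _ }
    exact subsingleton_H'_one hS U
      ((hP S hS (isFlasque_of_injective (Injective.under F)) hF).2 U hU)
      (Ext.subsingleton_of_injective _ (Injective.under F) 0)
  | succ i ih =>
    let S := ShortComplex.mk (Injective.ι F) (cokernel.π (Injective.ι F)) (cokernel.condition _)
    have hS : S.ShortExact := { exact := ShortComplex.exact_cokernel _ }
    exact subsingleton_H'_succ hS U (ih (hP S hS (isFlasque_of_injective (Injective.under F)) hF).1)
      (Ext.subsingleton_of_injective _ (Injective.under F) (i + 1))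

theorem isAcyclic_of_isFlasque (F : Sheaf (Opens.grothendieckTopology X) Ab.{u})
    (hF : TopCat.Sheaf.IsFlasque F) (U : Opens X) : IsAcyclic F U := by
  refine isAcyclic_of_forall_shortExact (fun F => TopCat.Sheaf.IsFlasque F) (fun _ => True) ?_ hF
    trivial
  intro S hS h₂ h₁
  exact ⟨TopCat.Sheaf.IsFlasque.of_shortExact_of_isFlasque₁₂ hS, fun U _ =>
    (AddCommGrpCat.epi_iff_surjective _).mp (TopCat.Sheaf.IsFlasque.epi_of_shortExact hS)⟩

end AdicGodement.AbSheaf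

/-! ### Sections of morphisms of `𝒪_X`-modules -/

namespace AdicGodement

open AbSheaf

variable {X : Scheme.{u}}

/-- The restriction of a section of `M` to a smaller open set. -/
noncomputable abbrev res (M : X.Modules) {U V : X.Opens} (h : V ≤ U) (s : Γ(M, U)) : Γ(M, V) :=
  M.presheaf.map (homOfLE h).op s

theorem res_res (M : X.Modules) {U V W : X.Opens} (h : V ≤ U) (h' : W ≤ V) (s : Γ(M, U)) :
    res M h' (res M h s) = res M (h'.trans h) s :=
  map_map_apply M h h' s

theorem res_self (M : X.Modules) {U : X.Opens} (s : Γ(M, U)) : res M le_rfl s = s :=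
  CategoryTheory.congr_fun (M.presheaf.map_id (op U)) s

theorem res_add (M : X.Modules) {U V : X.Opens} (h : V ≤ U) (s t : Γ(M, U)) :
    res M h (s + t) = res M h s + res M h t :=
  map_add (M.presheaf.map (homOfLE h).op).hom s t

theorem res_sub (M : X.Modules) {U V : X.Opens} (h : V ≤ U) (s t : Γ(M, U)) :
    res M h (s - t) = res M h s - res M h t :=
  map_sub (M.presheaf.map (homOfLE h).op).hom s t

theorem res_zero (M : X.Modules) {U V : X.Opens} (h : V ≤ U) : res M h (0 : Γ(M, U)) = 0 :=
  map_zero (M.presheaf.map (homOfLE h).op).hom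

theorem res_smul (M : X.Modules) {U V : X.Opens} (h : V ≤ U) (r : Γ(X, U)) (s : Γ(M, U)) :
    res M h (r • s) = X.presheaf.map (homOfLE h).op r • res M h s :=
  Scheme.Modules.map_smul M (homOfLE h) r s

theorem app_res {M N : X.Modules} (f : M ⟶ N) {U V : X.Opens} (h : V ≤ U) (s : Γ(M, U)) :
    f.app V (res M h s) = res N h (f.app U s) :=
  CategoryTheory.congr_fun (f.mapPresheaf.naturality (homOfLE h).op) s

theorem comp_app_apply {M N P : X.Modules} (f : M ⟶ N) (g : N ⟶ P) {U : X.Opens} (s : Γ(M, U)) :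
    (f ≫ g).app U s = g.app U (f.app U s) := rfl

theorem eq_of_res_eq (M : X.Modules) {U : X.Opens} {s t : Γ(M, U)}
    (h : ∀ x ∈ U, ∃ (V : X.Opens) (hV : V ≤ U), x ∈ V ∧ res M hV s = res M hV t) : s = t := by
  choose V hV hx he using h
  refine TopCat.Sheaf.eq_of_locally_eq' (F := ⟨M.presheaf, M.isSheaf⟩)
    (fun x : U => V x.1 x.2) U (fun x => homOfLE (hV x.1 x.2)) ?_ s t (fun x => he x.1 x.2)
  intro x hxU
  exact Opens.mem_iSup.mpr ⟨⟨x, hxU⟩, hx x hxU⟩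

theorem app_injective_of_mono {M N : X.Modules} (f : M ⟶ N) [Mono f] (U : X.Opens) :
    Function.Injective (f.app U) := by
  have : Mono ((Scheme.Modules.toPresheaf X).map f) := inferInstance
  have := (NatTrans.mono_iff_mono_app _).mp this (op U)
  exact (AddCommGrpCat.mono_iff_injective _).mp this

theorem mono_of_app_injective {M N : X.Modules} (f : M ⟶ N)
    (h : ∀ U, Function.Injective (f.app U)) : Mono f := by
  apply (Scheme.Modules.toPresheaf X).mono_of_mono_map
  rw [NatTrans.mono_iff_mono_app]
  intro U
  exact (AddCommGrpCat.mono_iff_injective _).mpr (h U.unop)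

/-- The section `s` of `N` lifts along `f` in a neighbourhood of each point. -/
def LiftsLocally {M N : X.Modules} (f : M ⟶ N) {U : X.Opens} (s : Γ(N, U)) : Prop :=
  ∀ x ∈ U, ∃ (V : X.Opens) (hV : V ≤ U), x ∈ V ∧ ∃ t, f.app V t = res N hV s

theorem epi_of_locallySurjective {M N : X.Modules} (f : M ⟶ N)
    (h : ∀ (U : X.Opens) (s : Γ(N, U)), LiftsLocally f s) : Epi f where
  left_cancellation g g' hg := by
    ext U s
    refine eq_of_res_eq _ fun x hx => ?_
    obtain ⟨V, hV, hxV, t, ht⟩ := h U s x hx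
    refine ⟨V, hV, hxV, ?_⟩
    rw [← app_res, ← app_res, ← ht]
    exact congrArg (fun k : M ⟶ _ => k.app V t) hg

theorem LiftsLocally.add {M N : X.Modules} {f : M ⟶ N} {U : X.Opens} {s s' : Γ(N, U)}
    (hs : LiftsLocally f s) (hs' : LiftsLocally f s') : LiftsLocally f (s + s') := by
  intro x hx
  obtain ⟨V, hV, hxV, t, ht⟩ := hs x hx
  obtain ⟨V', hV', hxV', t', ht'⟩ := hs' x hx
  refine ⟨V ⊓ V', inf_le_left.trans hV, ⟨hxV, hxV'⟩,
    res M inf_le_left t + res M inf_le_right t', ?_⟩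
  rw [map_add, app_res, app_res, ht, ht', res_res, res_res, res_add]

theorem LiftsLocally.map {M N : X.Modules} {f : M ⟶ N} {U W : X.Opens} {s : Γ(N, U)}
    (hs : LiftsLocally f s) (h : W ≤ U) : LiftsLocally f (res N h s) := by
  intro x hx
  obtain ⟨V, hV, hxV, t, ht⟩ := hs x (h hx)
  refine ⟨V ⊓ W, inf_le_right, ⟨hxV, hx⟩, res M inf_le_left t, ?_⟩
  rw [app_res, ht, res_res, res_res]

theorem LiftsLocally.smul {M N : X.Modules} {f : M ⟶ N} {U : X.Opens} {s : Γ(N, U)}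
    (hs : LiftsLocally f s) (r : Γ(X, U)) : LiftsLocally f (r • s) := by
  intro x hx
  obtain ⟨V, hV, hxV, t, ht⟩ := hs x hx
  refine ⟨V, hV, hxV, X.presheaf.map (homOfLE hV).op r • t, ?_⟩
  rw [Scheme.Modules.Hom.app_smul, ht, res_smul]

/-- The presheaf of modules of those sections of `N` which locally lift along `f`. -/
noncomputable def imageSubmodule {M N : X.Modules} (f : M ⟶ N) : N.val.Submodule where
  obj U :=
    { carrier := {s | LiftsLocally f (U := U.unop) s}
      add_mem' := fun hs ht => LiftsLocally.add hs ht
      zero_mem' := fun x hx => ⟨U.unop, le_rfl, hx, 0, by rw [map_zero]; exact (map_zero _).symm⟩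
      smul_mem' := fun r _ hs => LiftsLocally.smul hs r }
  map f := fun s hs => LiftsLocally.map (s := s) hs (leOfHom f.unop)

theorem imageSubmodule_isSheaf {M N : X.Modules} (f : M ⟶ N) :
    TopCat.Presheaf.IsSheaf (X := X.toPresheafedSpace)
      (imageSubmodule f).toPresheafOfModules.presheaf := by
  rw [TopCat.Presheaf.isSheaf_iff_isSheafUniqueGluing]
  intro ι U sf hsf
  obtain ⟨s, hs, huniq⟩ := TopCat.Presheaf.IsSheaf.isSheafUniqueGluing
    (F := N.presheaf) N.isSheaf U
    (fun i => show Γ(N, U i) from (sf i).1) (fun i j => congrArg Subtype.val (hsf i j))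
  refine ⟨⟨s, ?_⟩, fun i => Subtype.ext (hs i), fun t ht => Subtype.ext
    (huniq t.1 fun i => congrArg Subtype.val (ht i))⟩
  intro x hx
  obtain ⟨i, hxi⟩ := Opens.mem_iSup.mp hx
  obtain ⟨V, h, hxV, t, ht⟩ := (sf i).2 x hxi
  refine ⟨V, h.trans (le_iSup U i), hxV, t, ?_⟩
  have key : res N (le_iSup U i) s = (sf i).1 := hs i
  rw [← res_res N (le_iSup U i) h, key]
  exact ht

/-- An epimorphism factors through the subsheaf of sections which locally lift, so this subsheaf
is everything. -/
theorem locallySurjective_of_epi {M N : X.Modules} (f : M ⟶ N) [Epi f] (U : X.Opens) (s : Γ(N, U)) :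
    LiftsLocally f s := by
  intro x hx
  let I : X.Modules := ⟨(imageSubmodule f).toPresheafOfModules, imageSubmodule_isSheaf f⟩
  let ι : I ⟶ N := ⟨(imageSubmodule f).ι⟩
  let g : M ⟶ I :=
    ⟨PresheafOfModules.homMk
      { app := fun U => AddCommGrpCat.ofHom
          (AddMonoidHom.mk' (fun s => ⟨f.app U.unop s, fun x hx =>
            ⟨U.unop, le_rfl, hx, s, (res_self N _).symm⟩⟩)
            (fun s t => Subtype.ext (map_add (f.app U.unop).hom s t)))
        naturality := fun U V i => by
          ext s
          exact Subtype.ext (CategoryTheory.congr_fun (f.mapPresheaf.naturality i) s) }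
      (fun U r s => Subtype.ext (Scheme.Modules.Hom.app_smul (U := U.unop) (φ := f) r s))⟩
  have hg : g ≫ ι = f := rfl
  have : Mono ι := mono_of_app_injective ι fun U a b hab => Subtype.ext hab
  have : Epi ι := by
    have : Epi (g ≫ ι) := hg ▸ inferInstance
    exact epi_of_epi g ι
  have : IsIso ι := isIso_of_mono_of_epi ι
  have key : ι.app U ((inv ι).app U s) = s := by
    rw [← comp_app_apply, IsIso.inv_hom_id]
    rfl
  have := ((inv ι).app U s).2 x hx
  rw [← key]
  exact this

/-- The abelian sheaf underlying an `𝒪_X`-module. -/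
noncomputable def toSheaf (X : Scheme.{u}) :
    X.Modules ⥤ Sheaf (Opens.grothendieckTopology X) Ab.{u} :=
  SheafOfModules.toSheaf X.ringCatSheaf

instance : (toSheaf X).Additive where
  map_add := rfl

instance : PreservesFiniteLimits (toSheaf X) :=
  inferInstanceAs (PreservesFiniteLimits (SheafOfModules.toSheaf X.ringCatSheaf))

section ShortExact

variable {S : ShortComplex X.Modules}

theorem app_app_eq_zero (S : ShortComplex X.Modules) {U : X.Opens} (s : Γ(S.X₁, U)) :
    S.g.app U (S.f.app U s) = 0 := by
  rw [← comp_app_apply, S.zero]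
  rfl

theorem exists_app_eq (hS : S.Exact) [Mono S.f] {U : X.Opens} (s : Γ(S.X₂, U))
    (hs : S.g.app U s = 0) : ∃ t, S.f.app U t = s := by
  have h := (hS.map_of_mono_of_preservesKernel (Scheme.Modules.toPresheaf X)
    inferInstance inferInstance)
  exact TopCat.Presheaf.sections_exact_of_exact h hs

theorem exact_of_sections [Mono S.f]
    (h : ∀ (U : X.Opens) (s : Γ(S.X₂, U)), S.g.app U s = 0 → LiftsLocally S.f s) :
    S.Exact := by
  rw [S.exact_iff_epi_kernel_lift]
  refine epi_of_locallySurjective _ fun U s x hx => ?_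
  obtain ⟨V, hV, hxV, t, ht⟩ := h U ((kernel.ι S.g).app U s)
    (by rw [← comp_app_apply, kernel.condition]; rfl) x hx
  refine ⟨V, hV, hxV, t, app_injective_of_mono (kernel.ι S.g) V ?_⟩
  rw [app_res, ← ht, ← comp_app_apply, kernel.lift_ι]

theorem shortExact_toSheaf (hS : S.ShortExact) : (S.map (toSheaf X)).ShortExact := by
  have := hS.mono_f
  have := hS.epi_g
  have : Mono (S.map (toSheaf X)).f := inferInstanceAs (Mono ((toSheaf X).map S.f))
  refine { exact := ?_, mono_f := this, epi_g := ?_ }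
  · exact hS.exact.map_of_mono_of_preservesKernel (toSheaf X) inferInstance inferInstance
  · refine (TopCat.Sheaf.isLocallySurjective_iff_epi (S.map (toSheaf X)).g).mp ?_
    rw [TopCat.Presheaf.isLocallySurjective_iff]
    intro U t x hx
    obtain ⟨V, hV, hxV, s, hs⟩ := locallySurjective_of_epi S.g U t x hx
    exact ⟨V, hV, ⟨s, hs⟩, hxV⟩

theorem app_surjective_of_isAcyclicOn (hS : S.ShortExact) {U : X.Opens}
    (h : IsAcyclicOn S.X₁ U) : Function.Surjective (S.g.app U) :=
  sections_surjective_of_isAcyclic (shortExact_toSheaf hS) U h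

end ShortExact

end AdicGodement

/-! ### The quotients `M / J M` -/

namespace AdicGodement

open AbSheaf

variable {X : Scheme.{u}}

instance (J : X.IdealSheafData) (M : X.Modules) : Mono (mulι J M) :=
  mono_of_app_injective _ fun _ _ _ h => Subtype.ext h

theorem mul_shortExact (J : X.IdealSheafData) (M : X.Modules) :
    (ShortComplex.mk (mulι J M) (quotπ J M) (mulι_quotπ J M)).ShortExact :=
  { exact := ShortComplex.exact_cokernel (mulι J M)
    mono_f := inferInstanceAs (Mono (mulι J M))
    epi_g := inferInstanceAs (Epi (quotπ J M)) }

theorem quotπ_app_eq_zero_iff (J : X.IdealSheafData) (M : X.Modules) {U : X.Opens} (s : Γ(M, U)) :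
    (quotπ J M).app U s = 0 ↔ IsSectionOfMul J M s := by
  constructor
  · intro h
    have hS := mul_shortExact J M
    have := hS.mono_f
    obtain ⟨t, ht⟩ := exists_app_eq hS.exact (U := U) s h
    rw [← ht]
    exact t.2
  · intro h
    exact app_app_eq_zero (ShortComplex.mk (mulι J M) (quotπ J M) (mulι_quotπ J M))
      (U := U) ⟨s, h⟩

theorem quotMap_app_quotπ_app {J J' : X.IdealSheafData} (h : J ≤ J') {M N : X.Modules} (f : M ⟶ N)
    {U : X.Opens} (s : Γ(M, U)) :
    (quotMap h f).app U ((quotπ J M).app U s) = (quotπ J' N).app U (f.app U s) := by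
  rw [← comp_app_apply, quotπ_quotMap, comp_app_apply]

theorem isSectionOfMul_of_mem_smul_top {J : X.IdealSheafData} {M : X.Modules} {U : X.affineOpens}
    {s : Γ(M, U.1)} (hs : s ∈ (J.ideal U • ⊤ : Submodule Γ(X, U.1) Γ(M, U.1))) :
    IsSectionOfMul J M s :=
  fun _ hx => ⟨U, le_rfl, hx, by rwa [show M.presheaf.map _ s = s from res_self M s]⟩

theorem ideal_pow_eq (p : X.IdealSheafData) (n : ℕ) (U : X.affineOpens) :
    (p ^ n).ideal U = p.ideal U ^ n := by
  rw [Scheme.IdealSheafData.ideal_pow, Pi.pow_apply]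

/-- `Γ(U, M) ⊗ A / Iⁿ ⟶ Γ(U, M / pⁿ M)` is an isomorphism if and only if sections of `M / pⁿ M` lift
to `M` and every section of `pⁿ M` over `U` belongs to `Iⁿ Γ(U, M)`. -/
theorem tensorToSections_bijective_iff (p : X.IdealSheafData) (n : ℕ) (M : X.Modules)
    (U : X.affineOpens) :
    Function.Bijective (tensorToSections p n M U) ↔
      Function.Surjective ((quotπ (p ^ n) M).app U.1) ∧
      ∀ s : Γ(M, U.1), IsSectionOfMul (p ^ n) M s →
        s ∈ ((p ^ n).ideal U • ⊤ : Submodule Γ(X, U.1) Γ(M, U.1)) := by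
  let e := TensorProduct.tensorQuotEquivQuotSMul Γ(M, U.1) (p.ideal U ^ n)
  let L := Submodule.liftQ (p.ideal U ^ n • ⊤) (sectionsMap (quotπ (p ^ n) M) U.1)
    (smul_top_le_ker_quotπ (p ^ n) M U)
  have h1 : Function.Bijective (tensorToSections p n M U) ↔ Function.Bijective L :=
    Function.Bijective.of_comp_iff L e.bijective
  rw [h1, Function.Bijective, and_comm]
  refine and_congr ?_ ?_
  · exact (Function.Surjective.of_comp_iff L (g := Submodule.Quotient.mk)
      (Submodule.Quotient.mk_surjective _)).symm
  · rw [ideal_pow_eq, injective_iff_map_eq_zero]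
    constructor
    · intro h s hs
      rw [← Submodule.Quotient.mk_eq_zero]
      exact h _ ((quotπ_app_eq_zero_iff _ _ s).mpr hs)
    · intro h a ha
      obtain ⟨s, rfl⟩ := Submodule.Quotient.mk_surjective _ a
      rw [Submodule.Quotient.mk_eq_zero]
      exact h s ((quotπ_app_eq_zero_iff _ _ s).mp ha)

theorem isAcyclicOn_of_iso {M N : X.Modules} (e : M ≅ N) {U : X.Opens} (h : IsAcyclicOn M U) :
    IsAcyclicOn N U := by
  intro i hi
  have := h i hi
  let e' := (((Sheaf.cohomologyPresheafFunctor (Opens.grothendieckTopology X) i).mapIso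
    ((toSheaf X).mapIso e)).app (op U)).addCommGroupIsoToAddEquiv
  exact @Function.Injective.subsingleton _ _ _ e'.symm.toEquiv.injective this

theorem isAcyclicOn_of_isFlasque {M : X.Modules} (h : TopCat.Presheaf.IsFlasque M.presheaf)
    (U : X.Opens) : IsAcyclicOn M U :=
  isAcyclic_of_isFlasque ((toSheaf X).obj M) h U

/-- An isomorphism `M ≅ N` induces isomorphisms `M / J M ≅ N / J N`. -/
noncomputable def quotIso (J : X.IdealSheafData) {M N : X.Modules} (e : M ≅ N) :
    quot J M ≅ quot J N where
  hom := quotMap le_rfl e.hom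
  inv := quotMap le_rfl e.inv
  hom_inv_id := by rw [quotMap_comp, e.hom_inv_id, quotMap_id]
  inv_hom_id := by rw [quotMap_comp, e.inv_hom_id, quotMap_id]

theorem app_mem_smul_top {M N : X.Modules} (f : M ⟶ N) {U : X.Opens} (I : Ideal Γ(X, U))
    {s : Γ(M, U)} (hs : s ∈ (I • ⊤ : Submodule Γ(X, U) Γ(M, U))) :
    f.app U s ∈ (I • ⊤ : Submodule Γ(X, U) Γ(N, U)) := by
  have := Submodule.mem_map_of_mem (f := sectionsMap f U) hs
  rw [Submodule.map_smul''] at this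
  exact Submodule.smul_mono le_rfl le_top this

theorem iso_app_hom_inv {M N : X.Modules} (e : M ≅ N) {U : X.Opens} (s : Γ(N, U)) :
    e.hom.app U (e.inv.app U s) = s := by
  rw [← comp_app_apply, e.inv_hom_id]
  rfl

theorem isAffinelyAcyclic_of_iso (p : X.IdealSheafData) {M N : X.Modules} (e : M ≅ N)
    (h : IsAffinelyAcyclic p M) : IsAffinelyAcyclic p N := by
  intro U n
  obtain ⟨h1, h2, h3⟩ := h U n
  refine ⟨isAcyclicOn_of_iso e h1, isAcyclicOn_of_iso (quotIso _ e) h2, ?_⟩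
  rw [tensorToSections_bijective_iff] at h3 ⊢
  constructor
  · intro t
    obtain ⟨s, hs⟩ := h3.1 ((quotIso (p ^ n) e).inv.app U.1 t)
    refine ⟨e.hom.app U.1 s, ?_⟩
    rw [← quotMap_app_quotπ_app le_rfl, hs]
    exact iso_app_hom_inv (quotIso (p ^ n) e) t
  · intro s hs
    rw [← iso_app_hom_inv e s]
    exact app_mem_smul_top e.hom _ (h3.2 _ (hs.hom e.inv))

theorem exists_affine_le {U : X.Opens} {x : X} (hx : x ∈ U) :
    ∃ V : X.affineOpens, x ∈ V.1 ∧ V.1 ≤ U := by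
  obtain ⟨_, ⟨V, hV, rfl⟩, hxV, hle⟩ :=
    X.isBasis_affineOpens.exists_subset_of_mem_open hx U.isOpen
  exact ⟨⟨V, hV⟩, hxV, hle⟩

/-! ### Reduction modulo `J` of short exact sequences -/

theorem IsSectionOfMul.exists_lift {J : X.IdealSheafData} {M N : X.Modules} (g : M ⟶ N) [Epi g]
    {U : X.Opens} {s : Γ(N, U)} (hs : IsSectionOfMul J N s) {x : X} (hx : x ∈ U) :
    ∃ (V : X.Opens) (hV : V ≤ U), x ∈ V ∧ ∃ t, IsSectionOfMul J M t ∧ g.app V t = res N hV s := by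
  obtain ⟨V, hV, hxV, h⟩ := hs x hx
  suffices ∃ (W : X.Opens) (hW : W ≤ V.1), x ∈ W ∧ ∃ t, IsSectionOfMul J M t ∧
      g.app W t = res N hW (res N hV s) by
    obtain ⟨W, hW, hxW, t, ht, ht'⟩ := this
    exact ⟨W, hW.trans hV, hxW, t, ht, by rw [ht', res_res]⟩
  change res N hV s ∈ _ at h
  generalize res N hV s = z at h
  induction h using Submodule.smul_induction_on' with
  | smul r hr m _ =>
    obtain ⟨W, hW, hxW, t, ht⟩ := locallySurjective_of_epi g V.1 m x hxV
    refine ⟨W, hW, hxW, X.presheaf.map (homOfLE hW).op r • t, ?_, ?_⟩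
    · intro y hy
      obtain ⟨W', hyW', hle⟩ := exists_affine_le hy
      refine ⟨W', hle, hyW', ?_⟩
      change res M hle _ ∈ _
      rw [res_smul]
      refine Submodule.smul_mem_smul ?_ trivial
      rw [← ConcreteCategory.comp_apply, ← Functor.map_comp]
      exact J.ideal_le_comap_ideal (show W' ≤ V from hle.trans hW) hr
    · rw [Scheme.Modules.Hom.app_smul, ht, res_smul]
  | add a _ b _ ha hb =>
    obtain ⟨W, hW, hxW, t, ht, ht'⟩ := ha
    obtain ⟨W', hW', hxW', t', ht1, ht1'⟩ := hb
    refine ⟨W ⊓ W', inf_le_left.trans hW, ⟨hxW, hxW'⟩,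
      res M inf_le_left t + res M inf_le_right t', (ht.map _).add (ht1.map _), ?_⟩
    rw [map_add, app_res, app_res, ht', ht1', res_res, res_res, res_add]

/-- The sequence `X₁ / J X₁ ⟶ X₂ / J X₂ ⟶ X₃ / J X₃`. -/
noncomputable abbrev quotShortComplex (J : X.IdealSheafData) (S : ShortComplex X.Modules) :
    ShortComplex X.Modules :=
  ShortComplex.mk (quotMap (le_refl J) S.f) (quotMap (le_refl J) S.g)
    (by rw [quotMap_comp, S.zero, quotMap_zero])

/-- Reduction modulo `J` is right exact; it preserves the exactness of
`0 ⟶ X₁ ⟶ X₂ ⟶ X₃ ⟶ 0` if `X₁ ∩ J X₂ = J X₁`. -/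
theorem quotShortComplex_shortExact (J : X.IdealSheafData) {S : ShortComplex X.Modules}
    (hS : S.ShortExact)
    (h : ∀ (U : X.Opens) (s : Γ(S.X₁, U)), IsSectionOfMul J S.X₂ (S.f.app U s) →
      IsSectionOfMul J S.X₁ s) :
    (quotShortComplex J S).ShortExact := by
  have := hS.mono_f
  have := hS.epi_g
  have hmono : Mono (quotShortComplex J S).f := by
    refine mono_of_app_injective _ fun U => ?_
    rw [injective_iff_map_eq_zero]
    intro a ha
    refine eq_of_res_eq _ fun x hx => ?_
    obtain ⟨V, hV, hxV, t, ht⟩ := locallySurjective_of_epi (quotπ J S.X₁) U a x hx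
    refine ⟨V, hV, hxV, ?_⟩
    have h0 : (quotMap (le_refl J) S.f).app V (res (quot J S.X₁) hV a) = 0 :=
      (app_res _ hV a).trans ((congrArg _ ha).trans (res_zero _ _))
    rw [← ht, quotMap_app_quotπ_app, quotπ_app_eq_zero_iff] at h0
    have h1 := (quotπ_app_eq_zero_iff J S.X₁ t).mpr (h V t h0)
    rw [ht] at h1
    exact h1.trans (res_zero _ _).symm
  refine { exact := ?_, mono_f := hmono, epi_g := ?_ }
  · refine exact_of_sections fun U s hs x hx => ?_
    obtain ⟨V, hV, hxV, t, ht⟩ := locallySurjective_of_epi (quotπ J S.X₂) U s x hx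
    have h0 : (quotMap (le_refl J) S.g).app V (res (quot J S.X₂) hV s) = 0 :=
      (app_res _ hV s).trans ((congrArg _ hs).trans (res_zero _ _))
    rw [← ht, quotMap_app_quotπ_app, quotπ_app_eq_zero_iff] at h0
    obtain ⟨W, hW, hxW, b, hb, hb'⟩ := h0.exists_lift S.g hxV
    obtain ⟨a, ha⟩ := exists_app_eq hS.exact (U := W) (res _ hW t - b)
      (by rw [map_sub, hb', app_res, sub_self])
    refine ⟨W, hW.trans hV, hxW, (quotπ J S.X₁).app W a, ?_⟩
    refine (quotMap_app_quotπ_app (le_refl J) S.f a).trans ?_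
    rw [ha, map_sub, (quotπ_app_eq_zero_iff J S.X₂ b).mpr hb, sub_zero, app_res, ht]
    exact res_res _ _ _ _
  · have : Epi (quotπ J S.X₂ ≫ quotMap (le_refl J) S.g) := by
      rw [quotπ_quotMap]
      exact epi_comp _ _
    exact epi_of_epi (quotπ J S.X₂) (quotMap (le_refl J) S.g)

end AdicGodement

/-! ### Stalks of an ideal sheaf -/

namespace AdicGodement

variable {X : Scheme.{u}}

theorem map_germ_ideal_eq_of_le (J : X.IdealSheafData) {V W : X.affineOpens} (h : W ≤ V) {x : X}
    (hx : x ∈ W.1) :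
    (J.ideal V).map (X.presheaf.germ V.1 x (h hx)).hom =
      (J.ideal W).map (X.presheaf.germ W.1 x hx).hom := by
  rw [← J.map_ideal h, Ideal.map_map, ← CommRingCat.hom_comp]
  exact congrArg (fun f => (J.ideal V).map (CommRingCat.Hom.hom f))
    (X.presheaf.germ_res (homOfLE h) x hx).symm

/-- The stalk `J_x`, as an ideal of the local ring `𝒪_{X,x}`: the extension of `J(V)`, for an
arbitrary affine neighbourhood `V` of `x`. -/
noncomputable def stalkIdeal (J : X.IdealSheafData) (x : X) : Ideal (X.presheaf.stalk x) :=
  have h := exists_affine_le (show x ∈ (⊤ : X.Opens) from trivial)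
  (J.ideal h.choose).map (X.presheaf.germ h.choose.1 x h.choose_spec.1).hom

theorem map_germ_ideal (J : X.IdealSheafData) (V : X.affineOpens) {x : X} (hx : x ∈ V.1) :
    (J.ideal V).map (X.presheaf.germ V.1 x hx).hom = stalkIdeal J x := by
  have h := exists_affine_le (show x ∈ (⊤ : X.Opens) from trivial)
  obtain ⟨W, hxW, hW⟩ := exists_affine_le
    (show x ∈ V.1 ⊓ h.choose.1 from ⟨hx, h.choose_spec.1⟩)
  exact (map_germ_ideal_eq_of_le J (show W ≤ V from hW.trans inf_le_left) hxW).trans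
    (map_germ_ideal_eq_of_le J (show W ≤ h.choose from hW.trans inf_le_right) hxW).symm

/-- An element of `J_x M_x` is the germ of a section of `J M`. -/
theorem exists_germ_eq_of_mem_stalkIdeal_smul (J : X.IdealSheafData) (M : X.Modules) (x : X)
    (a : stalk M x) (ha : a ∈ (stalkIdeal J x • ⊤ : Submodule (X.presheaf.stalk x) (stalk M x))) :
    ∃ (W : X.affineOpens) (hx : x ∈ W.1) (t : Γ(M, W.1)),
      t ∈ (J.ideal W • ⊤ : Submodule Γ(X, W.1) Γ(M, W.1)) ∧ M.presheaf.germ W.1 x hx t = a := by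
  have hadd : ∀ a b : stalk M x,
      (∃ (W : X.affineOpens) (hx : x ∈ W.1) (t : Γ(M, W.1)),
        t ∈ (J.ideal W • ⊤ : Submodule Γ(X, W.1) Γ(M, W.1)) ∧ M.presheaf.germ W.1 x hx t = a) →
      (∃ (W : X.affineOpens) (hx : x ∈ W.1) (t : Γ(M, W.1)),
        t ∈ (J.ideal W • ⊤ : Submodule Γ(X, W.1) Γ(M, W.1)) ∧ M.presheaf.germ W.1 x hx t = b) →
      ∃ (W : X.affineOpens) (hx : x ∈ W.1) (t : Γ(M, W.1)),
        t ∈ (J.ideal W • ⊤ : Submodule Γ(X, W.1) Γ(M, W.1)) ∧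
          M.presheaf.germ W.1 x hx t = a + b := by
    rintro a b ⟨W, hx, t, ht, rfl⟩ ⟨W', hx', t', ht', rfl⟩
    obtain ⟨V, hxV, hV⟩ := exists_affine_le (show x ∈ W.1 ⊓ W'.1 from ⟨hx, hx'⟩)
    refine ⟨V, hxV, res M (hV.trans inf_le_left) t + res M (hV.trans inf_le_right) t',
      add_mem (map_mem_smul_top J M _ ht) (map_mem_smul_top J M _ ht'), ?_⟩
    rw [map_add, TopCat.Presheaf.germ_res_apply, TopCat.Presheaf.germ_res_apply]
  induction ha using Submodule.smul_induction_on' with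
  | add a _ b _ ha hb => exact hadd a b ha hb
  | smul r hr m _ =>
    obtain ⟨V, hxV, -⟩ := exists_affine_le (show x ∈ (⊤ : X.Opens) from trivial)
    rw [← map_germ_ideal J V hxV] at hr
    induction hr using Submodule.span_induction generalizing m with
    | mem r hr =>
      obtain ⟨j, hj, rfl⟩ := hr
      obtain ⟨U, hxU, m, rfl⟩ := M.presheaf.exists_germ_eq m
      obtain ⟨W, hxW, hW⟩ := exists_affine_le (show x ∈ V.1 ⊓ U from ⟨hxV, hxU⟩)
      refine ⟨W, hxW, X.presheaf.map (homOfLE (hW.trans inf_le_left)).op j •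
        res M (hW.trans inf_le_right) m, Submodule.smul_mem_smul
          (J.ideal_le_comap_ideal (show W ≤ V from hW.trans inf_le_left) hj) trivial, ?_⟩
      rw [germ_smul, TopCat.Presheaf.germ_res_apply, TopCat.Presheaf.germ_res_apply]
    | zero =>
      refine ⟨V, hxV, 0, zero_mem _, ?_⟩
      rw [map_zero, zero_smul]
    | add r r' _ _ hr hr' =>
      rw [add_smul]
      exact hadd _ _ (hr m trivial) (hr' m trivial)
    | smul c r _ hr =>
      rw [smul_eq_mul, mul_comm, mul_smul]
      exact hr _ trivial

theorem germ_mem_stalkIdeal_smul (J : X.IdealSheafData) (M : X.Modules) (V : X.affineOpens) {x : X}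
    (hx : x ∈ V.1) {s : Γ(M, V.1)} (hs : s ∈ (J.ideal V • ⊤ : Submodule Γ(X, V.1) Γ(M, V.1))) :
    (M.presheaf.germ V.1 x hx s : stalk M x) ∈
      (stalkIdeal J x • ⊤ : Submodule (X.presheaf.stalk x) (stalk M x)) := by
  induction hs using Submodule.smul_induction_on' with
  | smul r hr m _ =>
    rw [germ_smul, ← map_germ_ideal J V hx]
    exact Submodule.smul_mem_smul (Ideal.mem_map_of_mem _ hr) trivial
  | add a _ b _ ha hb =>
    rw [map_add]
    exact add_mem ha hb

/-- A section of `M` is a section of `J M` if and only if all its germs lie in `J_x M_x`. -/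
theorem isSectionOfMul_iff_germ (J : X.IdealSheafData) (M : X.Modules) {U : X.Opens} (s : Γ(M, U)) :
    IsSectionOfMul J M s ↔ ∀ (x : X) (hx : x ∈ U), (M.presheaf.germ U x hx s : stalk M x) ∈
      (stalkIdeal J x • ⊤ : Submodule (X.presheaf.stalk x) (stalk M x)) := by
  constructor
  · intro hs x hx
    obtain ⟨V, hV, hxV, h⟩ := hs x hx
    have := germ_mem_stalkIdeal_smul J M V hxV h
    rwa [TopCat.Presheaf.germ_res_apply] at this
  · intro hs x hx
    obtain ⟨W, hxW, t, ht, hts⟩ := exists_germ_eq_of_mem_stalkIdeal_smul J M x _ (hs x hx)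
    obtain ⟨V, hxV, i, j, hij⟩ := M.presheaf.germ_eq x hxW hx t s hts
    obtain ⟨V', hxV', hV'⟩ := exists_affine_le hxV
    refine ⟨V', hV'.trans (leOfHom j), hxV', ?_⟩
    change res M _ s ∈ _
    rw [← res_res M (leOfHom j) hV']
    rw [show res M (leOfHom j) s = res M (leOfHom i) t from hij.symm, res_res]
    exact map_mem_smul_top J M _ ht

/-! ### The sheaf of discontinuous sections modulo `J` -/

/-- The family of elements of the stalks given by a section of `C⁰ M`. -/
def gval {M : X.Modules} {U : X.Opens} (s : Γ(godement₀ M, U)) : ∀ x : U, stalk M x.1 := s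

/-- The section of `C⁰ M` given by a family of elements of the stalks. -/
def gmk {M : X.Modules} {U : X.Opens} (s : ∀ x : U, stalk M x.1) : Γ(godement₀ M, U) := s

theorem gval_add {M : X.Modules} {U : X.Opens} (s t : Γ(godement₀ M, U)) (x : U) :
    gval (s + t) x = gval s x + gval t x := rfl

theorem gval_smul {M : X.Modules} {U : X.Opens} (r : Γ(X, U)) (s : Γ(godement₀ M, U)) (x : U) :
    gval (r • s) x = X.presheaf.germ U x.1 x.2 r • gval s x := rfl

open Classical in
/-- The extension by zero of a discontinuous section. -/
noncomputable def extendZero {M : X.Modules} {V : X.Opens} (U : X.Opens) :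
    Γ(godement₀ M, V) →+ Γ(godement₀ M, U) where
  toFun s := gmk fun x => if h : x.1 ∈ V then gval s ⟨x.1, h⟩ else 0
  map_zero' := by
    funext x
    change (if h : x.1 ∈ V then gval (0 : Γ(godement₀ M, V)) ⟨x.1, h⟩ else (0 : stalk M x.1)) = 0
    split_ifs <;> rfl
  map_add' s t := by
    funext x
    change (if h : x.1 ∈ V then gval (s + t) ⟨x.1, h⟩ else (0 : stalk M x.1)) =
      (if h : x.1 ∈ V then gval s ⟨x.1, h⟩ else (0 : stalk M x.1)) +
        (if h : x.1 ∈ V then gval t ⟨x.1, h⟩ else (0 : stalk M x.1))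
    split_ifs
    · rfl
    · rw [add_zero]

theorem gval_extendZero_of_mem {M : X.Modules} {V U : X.Opens} (s : Γ(godement₀ M, V)) (x : U)
    (h : x.1 ∈ V) : gval (extendZero U s) x = gval s ⟨x.1, h⟩ :=
  dif_pos h

theorem gval_extendZero_of_notMem {M : X.Modules} {V U : X.Opens} (s : Γ(godement₀ M, V)) (x : U)
    (h : x.1 ∉ V) : gval (extendZero U s) x = 0 :=
  dif_neg h

theorem res_extendZero {M : X.Modules} {V U : X.Opens} (h : V ≤ U) (s : Γ(godement₀ M, V)) :
    res (godement₀ M) h (extendZero U s) = s := by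
  funext x
  exact gval_extendZero_of_mem s ⟨x.1, h x.2⟩ x.2

theorem exists_eq_sum_smul {R M : Type*} [CommRing R] [AddCommGroup M] [Module R M] {ι : Type*}
    [Fintype ι] (a : ι → R) {m : M}
    (hm : m ∈ (Ideal.span (Set.range a) • ⊤ : Submodule R M)) :
    ∃ t : ι → M, m = ∑ i, a i • t i := by
  induction hm using Submodule.smul_induction_on' with
  | smul r hr m _ =>
    obtain ⟨c, rfl⟩ := (Ideal.mem_span_range_iff_exists_fun).mp hr
    refine ⟨fun i => c i • m, ?_⟩
    rw [Finset.sum_smul]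
    exact Finset.sum_congr rfl fun i _ => by rw [smul_smul, mul_comm]
  | add x _ y _ hx hy =>
    obtain ⟨t, rfl⟩ := hx
    obtain ⟨t', rfl⟩ := hy
    refine ⟨t + t', ?_⟩
    rw [← Finset.sum_add_distrib]
    exact Finset.sum_congr rfl fun i _ => (smul_add _ _ _).symm

/-- For a finitely generated ideal `I`, one has `I ∏ M_x = ∏ I M_x`. -/
theorem mem_smul_top_of_gval_mem (J : X.IdealSheafData) (M : X.Modules) (U : X.affineOpens)
    (hJ : (J.ideal U).FG) {s : Γ(godement₀ M, U.1)}
    (hs : ∀ x : U.1, gval s x ∈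
      (stalkIdeal J x.1 • ⊤ : Submodule (X.presheaf.stalk x.1) (stalk M x.1))) :
    s ∈ (J.ideal U • ⊤ : Submodule Γ(X, U.1) Γ(godement₀ M, U.1)) := by
  obtain ⟨n, a, ha⟩ := Submodule.fg_iff_exists_fin_generating_family.mp hJ
  have h : ∀ x : U.1, ∃ t : Fin n → stalk M x.1,
      gval s x = ∑ i, X.presheaf.germ U.1 x.1 x.2 (a i) • t i := by
    intro x
    refine exists_eq_sum_smul (fun i => X.presheaf.germ U.1 x.1 x.2 (a i)) ?_
    have := hs x
    rw [← map_germ_ideal J U x.2, ← ha, ← Ideal.span, Ideal.map_span, ← Set.range_comp] at this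
    exact this
  choose t ht using h
  have hsum : s = ∑ i, a i • (gmk (fun x => t x i) : Γ(godement₀ M, U.1)) := by
    funext x
    refine (ht x).trans ?_
    exact (Finset.sum_apply x Finset.univ
      (fun i (y : U.1) => X.presheaf.germ U.1 y.1 y.2 (a i) • t y i)).symm
  rw [hsum]
  refine sum_mem fun i _ => Submodule.smul_mem_smul ?_ trivial
  rw [← ha]
  exact Submodule.subset_span ⟨i, rfl⟩

theorem gval_mem_of_mem_smul_top (J : X.IdealSheafData) (M : X.Modules) (U : X.affineOpens)
    {s : Γ(godement₀ M, U.1)}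
    (hs : s ∈ (J.ideal U • ⊤ : Submodule Γ(X, U.1) Γ(godement₀ M, U.1))) (x : U.1) :
    gval s x ∈ (stalkIdeal J x.1 • ⊤ : Submodule (X.presheaf.stalk x.1) (stalk M x.1)) := by
  induction hs using Submodule.smul_induction_on' with
  | smul r hr m _ =>
    rw [gval_smul, ← map_germ_ideal J U x.2]
    exact Submodule.smul_mem_smul (Ideal.mem_map_of_mem _ hr) trivial
  | add a _ b _ ha hb =>
    rw [gval_add]
    exact add_mem ha hb

/-- For `J` of finite type, the sections of `J C⁰ M` are the families in `∏ J_x M_x`. -/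
theorem isSectionOfMul_godement₀_iff (J : X.IdealSheafData)
    (hJ : ∀ U : X.affineOpens, (J.ideal U).FG)
    (M : X.Modules) {U : X.Opens} (s : Γ(godement₀ M, U)) :
    IsSectionOfMul J (godement₀ M) s ↔ ∀ x : U, gval s x ∈
      (stalkIdeal J x.1 • ⊤ : Submodule (X.presheaf.stalk x.1) (stalk M x.1)) := by
  constructor
  · intro hs x
    obtain ⟨V, hV, hxV, h⟩ := hs x.1 x.2
    exact gval_mem_of_mem_smul_top J M V h ⟨x.1, hxV⟩
  · intro hs x hx
    obtain ⟨V, hxV, hV⟩ := exists_affine_le hx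
    refine ⟨V, hV, hxV, mem_smul_top_of_gval_mem J M V (hJ V) fun y => ?_⟩
    exact hs ⟨y.1, hV y.2⟩

theorem IsSectionOfMul.extendZero {J : X.IdealSheafData} (hJ : ∀ U : X.affineOpens, (J.ideal U).FG)
    {M : X.Modules} {V : X.Opens} {s : Γ(godement₀ M, V)} (hs : IsSectionOfMul J (godement₀ M) s)
    (U : X.Opens) : IsSectionOfMul J (godement₀ M) (extendZero U s) := by
  rw [isSectionOfMul_godement₀_iff J hJ] at hs ⊢
  intro x
  by_cases h : x.1 ∈ V
  · rw [gval_extendZero_of_mem s x h]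
    exact hs ⟨x.1, h⟩
  · rw [gval_extendZero_of_notMem s x h]
    exact zero_mem _

theorem isFlasque_of_res_surjective {M : X.Modules}
    (h : ∀ (U V : X.Opens) (h : V ≤ U) (s : Γ(M, V)), ∃ t, res M h t = s) :
    TopCat.Presheaf.IsFlasque M.presheaf where
  epi i := (AddCommGrpCat.epi_iff_surjective _).mpr (h _ _ (leOfHom i.unop))

theorem isFlasque_godement₀ (M : X.Modules) : TopCat.Presheaf.IsFlasque (godement₀ M).presheaf :=
  isFlasque_of_res_surjective fun U _ h s => ⟨extendZero U s, res_extendZero h s⟩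

theorem isFlasque_mul_godement₀ (J : X.IdealSheafData) (hJ : ∀ U : X.affineOpens, (J.ideal U).FG)
    (M : X.Modules) : TopCat.Presheaf.IsFlasque (mul J (godement₀ M)).presheaf :=
  isFlasque_of_res_surjective fun U _ h s =>
    ⟨⟨extendZero U s.1, s.2.extendZero hJ U⟩, Subtype.ext (res_extendZero h s.1)⟩

theorem quotπ_godement₀_app_surjective (J : X.IdealSheafData)
    (hJ : ∀ U : X.affineOpens, (J.ideal U).FG) (M : X.Modules) (U : X.Opens) :
    Function.Surjective ((quotπ J (godement₀ M)).app U) :=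
  app_surjective_of_isAcyclicOn (mul_shortExact J (godement₀ M))
    (isAcyclicOn_of_isFlasque (isFlasque_mul_godement₀ J hJ M) U)

theorem isFlasque_quot_godement₀ (J : X.IdealSheafData)
    (hJ : ∀ U : X.affineOpens, (J.ideal U).FG) (M : X.Modules) :
    TopCat.Presheaf.IsFlasque (quot J (godement₀ M)).presheaf :=
  isFlasque_of_res_surjective fun U V h s => by
    obtain ⟨t, rfl⟩ := quotπ_godement₀_app_surjective J hJ M V s
    exact ⟨(quotπ J (godement₀ M)).app U (extendZero U t), by rw [← app_res, res_extendZero]⟩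

instance mono_toGodement₀ (M : X.Modules) : Mono (toGodement₀ M) :=
  mono_of_app_injective _ fun U s t h =>
    TopCat.Presheaf.section_ext ⟨M.presheaf, M.isSheaf⟩ U s t fun x hx => congrFun h ⟨x, hx⟩

/-- `M / J M ⟶ C⁰ M / J C⁰ M` is injective, since being a section of `J M` is a condition on
germs. -/
theorem isSectionOfMul_of_toGodement₀ (J : X.IdealSheafData)
    (hJ : ∀ U : X.affineOpens, (J.ideal U).FG) (M : X.Modules) {U : X.Opens} {s : Γ(M, U)}
    (hs : IsSectionOfMul J (godement₀ M) ((toGodement₀ M).app U s)) : IsSectionOfMul J M s := by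
  rw [isSectionOfMul_godement₀_iff J hJ] at hs
  rw [isSectionOfMul_iff_germ]
  exact fun x hx => hs ⟨x, hx⟩

end AdicGodement

/-! ### Affine acyclicity of the Godement cosyzygies -/

namespace AdicGodement

open AbSheaf

variable {X : Scheme.{u}}

theorem pow_ideal_fg {p : X.IdealSheafData} (hp : ∀ U : X.affineOpens, (p.ideal U).FG) (n : ℕ)
    (U : X.affineOpens) : ((p ^ n).ideal U).FG := by
  rw [ideal_pow_eq]
  exact (hp U).pow

/-- The sequence `M ⟶ C⁰ M ⟶ Coker (M ⟶ C⁰ M)`. -/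
noncomputable abbrev godementShortComplex (M : X.Modules) : ShortComplex X.Modules :=
  ShortComplex.mk (toGodement₀ M) (cokernel.π (toGodement₀ M)) (cokernel.condition _)

theorem godementShortComplex_shortExact (M : X.Modules) : (godementShortComplex M).ShortExact :=
  { exact := ShortComplex.exact_cokernel (toGodement₀ M)
    mono_f := mono_toGodement₀ M
    epi_g := inferInstanceAs (Epi (cokernel.π (toGodement₀ M))) }

theorem quot_godementShortComplex_shortExact (J : X.IdealSheafData)
    (hJ : ∀ U : X.affineOpens, (J.ideal U).FG) (M : X.Modules) :
    (quotShortComplex J (godementShortComplex M)).ShortExact :=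
  quotShortComplex_shortExact J (godementShortComplex_shortExact M)
    fun _ _ hs => isSectionOfMul_of_toGodement₀ J hJ M hs

/-- Acyclicity passes to cokernels of embeddings into flasque sheaves. For the comparison of
sections, let `g` be a section of `C⁰ M` over `U` whose image in the cokernel `Q` is a section of
`pⁿ Q`; it differs from a section of `M` by a section of `pⁿ C⁰ M`, and
`Γ(U, pⁿ C⁰ M) = p(U)ⁿ Γ(U, C⁰ M)`. -/
theorem isAffinelyAcyclic_cokernel_toGodement₀ {p : X.IdealSheafData}
    (hp : ∀ U : X.affineOpens, (p.ideal U).FG) {M : X.Modules} (hM : IsAffinelyAcyclic p M) :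
    IsAffinelyAcyclic p (cokernel (toGodement₀ M)) := by
  intro U n
  obtain ⟨h1, h2, h3⟩ := hM U n
  have hS := godementShortComplex_shortExact M
  have hS' := quot_godementShortComplex_shortExact (p ^ n) (pow_ideal_fg hp n) M
  have := hS'.mono_f
  refine ⟨isAcyclic_X₃ (shortExact_toSheaf hS) U.1 h1
      (isAcyclicOn_of_isFlasque (isFlasque_godement₀ M) U.1),
    isAcyclic_X₃ (shortExact_toSheaf hS') U.1 h2 (isAcyclicOn_of_isFlasque
      (isFlasque_quot_godement₀ (p ^ n) (pow_ideal_fg hp n) M) U.1), ?_⟩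
  rw [tensorToSections_bijective_iff] at h3 ⊢
  constructor
  · intro t
    obtain ⟨b, rfl⟩ := app_surjective_of_isAcyclicOn hS' h2 t
    obtain ⟨g, rfl⟩ := quotπ_godement₀_app_surjective (p ^ n) (pow_ideal_fg hp n) M U.1 b
    exact ⟨(cokernel.π (toGodement₀ M)).app U.1 g, (quotMap_app_quotπ_app le_rfl _ g).symm⟩
  · intro s hs
    obtain ⟨g, rfl⟩ := app_surjective_of_isAcyclicOn hS h1 s
    obtain ⟨a, ha⟩ := exists_app_eq hS'.exact ((quotπ (p ^ n) (godement₀ M)).app U.1 g)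
      ((quotMap_app_quotπ_app le_rfl _ g).trans ((quotπ_app_eq_zero_iff _ _ _).mpr hs))
    obtain ⟨m, rfl⟩ := h3.1 a
    have hg : IsSectionOfMul (p ^ n) (godement₀ M) (g - (toGodement₀ M).app U.1 m) := by
      rw [← quotπ_app_eq_zero_iff, map_sub, sub_eq_zero, ← ha]
      exact quotMap_app_quotπ_app le_rfl _ m
    have hg' : g - (toGodement₀ M).app U.1 m ∈ ((p ^ n).ideal U • ⊤ : Submodule Γ(X, U.1) _) :=
      mem_smul_top_of_gval_mem (p ^ n) M U (pow_ideal_fg hp n U)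
        ((isSectionOfMul_godement₀_iff (p ^ n) (pow_ideal_fg hp n) M _).mp hg)
    have := app_mem_smul_top (cokernel.π (toGodement₀ M)) _ hg'
    rw [map_sub, app_app_eq_zero (godementShortComplex M) m, sub_zero] at this
    exact this

theorem isAffinelyAcyclic_godementCosyzygy {p : X.IdealSheafData}
    (hp : ∀ U : X.affineOpens, (p.ideal U).FG) {M : X.Modules} (hM : IsAffinelyAcyclic p M) :
    ∀ i, IsAffinelyAcyclic p (godementCosyzygy M i)
  | 0 => hM
  | i + 1 => isAffinelyAcyclic_cokernel_toGodement₀ hp (isAffinelyAcyclic_godementCosyzygy hp hM i)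

/-! ### Sections of the completion -/

/-- The projection from the completion of `M` to `M / pⁿ M`. -/
noncomputable def completionπ (p : X.IdealSheafData) (M : X.Modules) (n : ℕ) :
    (completion p).obj M ⟶ quot (p ^ n) M :=
  limit.π ((adicTower p).obj M) (op n)

/-- The transition morphism `M / pⁿ⁺¹ M ⟶ M / pⁿ M`. -/
noncomputable def transition (p : X.IdealSheafData) (M : X.Modules) (n : ℕ) :
    quot (p ^ (n + 1)) M ⟶ quot (p ^ n) M :=
  quotMap (pow_le_pow_ideal p n.le_succ) (𝟙 M)

theorem transition_app_quotπ_app (p : X.IdealSheafData) (M : X.Modules) (n : ℕ) {U : X.Opens}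
    (s : Γ(M, U)) :
    (transition p M n).app U ((quotπ (p ^ (n + 1)) M).app U s) = (quotπ (p ^ n) M).app U s :=
  quotMap_app_quotπ_app _ (𝟙 M) s

theorem transition_app_quotMap_app (p : X.IdealSheafData) {M N : X.Modules} (f : M ⟶ N) (n : ℕ)
    {U : X.Opens} (s : Γ(quot (p ^ (n + 1)) M, U)) :
    (transition p N n).app U ((quotMap le_rfl f).app U s) =
      (quotMap le_rfl f).app U ((transition p M n).app U s) := by
  rw [← comp_app_apply, ← comp_app_apply, transition, transition, quotMap_comp, quotMap_comp,
    Category.id_comp, Category.comp_id]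

theorem completion_map_completionπ (p : X.IdealSheafData) {M N : X.Modules} (f : M ⟶ N) (n : ℕ) :
    (completion p).map f ≫ completionπ p N n = completionπ p M n ≫ quotMap le_rfl f :=
  limMap_π _ _

theorem completionπ_app_map_app (p : X.IdealSheafData) {M N : X.Modules} (f : M ⟶ N) (n : ℕ)
    {U : X.Opens} (s : Γ((completion p).obj M, U)) :
    (completionπ p N n).app U (((completion p).map f).app U s) =
      (quotMap le_rfl f).app U ((completionπ p M n).app U s) := by
  rw [← comp_app_apply, completion_map_completionπ, comp_app_apply]

theorem transition_app_completionπ_app (p : X.IdealSheafData) (M : X.Modules) (n : ℕ) {U : X.Opens}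
    (s : Γ((completion p).obj M, U)) :
    (transition p M n).app U ((completionπ p M (n + 1)).app U s) = (completionπ p M n).app U s := by
  rw [← comp_app_apply]
  exact congrArg (fun f : (completion p).obj M ⟶ _ => f.app U s)
    (limit.w ((adicTower p).obj M) (homOfLE n.le_succ).op)

/-- The functor of sections over `U`, with values in sets. -/
noncomputable abbrev sectionsFunctor (U : X.Opens) : X.Modules ⥤ Type u :=
  Scheme.Modules.toPresheaf X ⋙ (evaluation (Opens X)ᵒᵖ Ab.{u}).obj (op U) ⋙ forget Ab.{u}

instance : PreservesLimitsOfShape ℕᵒᵖ (Scheme.Modules.toPresheaf X) :=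
  have := preservesSmallestLimits_of_preservesLimits (Scheme.Modules.toPresheaf X)
  inferInstance

instance (U : X.Opens) : PreservesLimitsOfShape ℕᵒᵖ (sectionsFunctor U) :=
  have : PreservesLimitsOfShape ℕᵒᵖ (forget Ab.{u}) := inferInstance
  have : PreservesLimitsOfShape ℕᵒᵖ ((evaluation (Opens X)ᵒᵖ Ab.{u}).obj (op U)) := inferInstance
  have : PreservesLimitsOfShape ℕᵒᵖ ((evaluation (Opens X)ᵒᵖ Ab.{u}).obj (op U) ⋙ forget Ab.{u}) :=
    comp_preservesLimitsOfShape _ _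
  comp_preservesLimitsOfShape (Scheme.Modules.toPresheaf X) _

/-- The sections of the completion over `U` form the limit of the sections of the quotients. -/
noncomputable def isLimitSections (p : X.IdealSheafData) (M : X.Modules) (U : X.Opens) :
    IsLimit ((sectionsFunctor U).mapCone (limit.cone ((adicTower p).obj M))) :=
  isLimitOfPreserves _ (limit.isLimit _)

theorem completion_section_ext (p : X.IdealSheafData) (M : X.Modules) {U : X.Opens}
    {s t : Γ((completion p).obj M, U)}
    (h : ∀ n, (completionπ p M n).app U s = (completionπ p M n).app U t) : s = t :=
  (Types.isLimitEquivSections (isLimitSections p M U)).injective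
    (Subtype.ext (funext fun n => h n.unop))

theorem exists_completion_section (p : X.IdealSheafData) (M : X.Modules) {U : X.Opens}
    (t : ∀ n, Γ(quot (p ^ n) M, U)) (ht : ∀ n, (transition p M n).app U (t (n + 1)) = t n) :
    ∃ s : Γ((completion p).obj M, U), ∀ n, (completionπ p M n).app U s = t n := by
  have hle : ∀ m n (h : n ≤ m), (quotMap (pow_le_pow_ideal p h) (𝟙 M)).app U (t m) = t n := by
    intro m n h
    induction m, h using Nat.le_induction with
    | base => exact congrArg (fun f : quot (p ^ n) M ⟶ _ => f.app U (t n)) (quotMap_id (p ^ n) M)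
    | succ m h ih =>
      rw [← ih, ← ht m, transition, ← comp_app_apply, quotMap_comp, Category.comp_id]
  let c : (((adicTower p).obj M) ⋙ sectionsFunctor U).sections :=
    ⟨fun n => t n.unop, fun {m n} i => hle m.unop n.unop (leOfHom i.unop)⟩
  refine ⟨(Types.isLimitEquivSections (isLimitSections p M U)).symm c, fun n => ?_⟩
  exact Types.isLimitEquivSections_symm_apply (isLimitSections p M U) c (op n)

/-! ### Completion of the Godement sequences -/

/-- The completion of `C⁰ M` is flasque: a compatible family of classes of discontinuous sections
can be extended by zero. -/
theorem isFlasque_completion_godement₀ {p : X.IdealSheafData}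
    (hp : ∀ U : X.affineOpens, (p.ideal U).FG) (M : X.Modules) :
    TopCat.Presheaf.IsFlasque ((completion p).obj (godement₀ M)).presheaf :=
  isFlasque_of_res_surjective fun U V h s => by
    choose g hg using fun n => quotπ_godement₀_app_surjective (p ^ n) (pow_ideal_fg hp n) M V
      ((completionπ p (godement₀ M) n).app V s)
    obtain ⟨t, ht⟩ := exists_completion_section p (godement₀ M) (U := U)
      (fun n => (quotπ (p ^ n) (godement₀ M)).app U (extendZero U (g n))) (fun n => by
        rw [transition_app_quotπ_app, ← sub_eq_zero, ← map_sub, ← map_sub,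
          quotπ_app_eq_zero_iff]
        refine IsSectionOfMul.extendZero (pow_ideal_fg hp n) ?_ U
        rw [← quotπ_app_eq_zero_iff, map_sub, hg, ← transition_app_quotπ_app, hg,
          transition_app_completionπ_app, sub_self])
    refine ⟨t, completion_section_ext p _ fun n => ?_⟩
    rw [app_res, ht, ← app_res, res_extendZero, hg]

/-- Over an affine open set, lifting along the surjections `C⁰ M / pⁿ ⟶ Q / pⁿ` compatibly in `n`
is possible by the Mittag-Leffler condition: sections of `M / pⁿ M` lift to `M`. -/
theorem exists_transition_app_eq {p : X.IdealSheafData}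
    (hp : ∀ U : X.affineOpens, (p.ideal U).FG) {M : X.Modules} (hM : IsAffinelyAcyclic p M)
    (U : X.affineOpens) (n : ℕ) (q : Γ(quot (p ^ (n + 1)) (cokernel (toGodement₀ M)), U.1))
    (g : Γ(quot (p ^ n) (godement₀ M), U.1))
    (hg : (quotMap le_rfl (cokernel.π (toGodement₀ M))).app U.1 g =
      (transition p _ n).app U.1 q) :
    ∃ g' : Γ(quot (p ^ (n + 1)) (godement₀ M), U.1),
      (quotMap le_rfl (cokernel.π (toGodement₀ M))).app U.1 g' = q ∧
        (transition p _ n).app U.1 g' = g := by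
  have hS := fun n => quot_godementShortComplex_shortExact (p ^ n) (pow_ideal_fg hp n) M
  have := (hS n).mono_f
  obtain ⟨b, hb⟩ : ∃ b, (quotMap le_rfl (cokernel.π (toGodement₀ M))).app U.1 b = q :=
    app_surjective_of_isAcyclicOn (hS (n + 1)) (hM U (n + 1)).2.1 q
  obtain ⟨a, ha⟩ := exists_app_eq (hS n).exact ((transition p _ n).app U.1 b - g) (by
    refine (map_sub ((quotMap le_rfl (cokernel.π (toGodement₀ M))).app U.1).hom _ _).trans ?_
    rw [sub_eq_zero]
    refine Eq.trans ?_ hg.symm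
    exact (transition_app_quotMap_app p _ n b).symm.trans (congrArg _ hb))
  obtain ⟨m, rfl⟩ := ((tensorToSections_bijective_iff p n M U).mp (hM U n).2.2).1 a
  refine ⟨b - (quotπ (p ^ (n + 1)) (godement₀ M)).app U.1 ((toGodement₀ M).app U.1 m), ?_, ?_⟩
  · rw [map_sub, hb, quotMap_app_quotπ_app, app_app_eq_zero (godementShortComplex M) m, map_zero,
      sub_zero]
  · rw [map_sub, transition_app_quotπ_app]
    have ha' : (quotπ (p ^ n) (godement₀ M)).app U.1 ((toGodement₀ M).app U.1 m) =
        (transition p _ n).app U.1 b - g :=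
      (quotMap_app_quotπ_app le_rfl (toGodement₀ M) m).symm.trans ha
    rw [ha', sub_sub_cancel]

/-- The completion of `0 ⟶ M ⟶ C⁰ M ⟶ Coker (M ⟶ C⁰ M) ⟶ 0` is exact. -/
theorem completion_godementShortComplex_shortExact {p : X.IdealSheafData}
    (hp : ∀ U : X.affineOpens, (p.ideal U).FG) {M : X.Modules} (hM : IsAffinelyAcyclic p M) :
    ((godementShortComplex M).map (completion p)).ShortExact := by
  have hS := fun n => quot_godementShortComplex_shortExact (p ^ n) (pow_ideal_fg hp n) M
  have hinj : ∀ n (U : X.Opens), Function.Injective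
      ((quotMap (le_refl (p ^ n)) (toGodement₀ M)).app U) := fun n U =>
    have := (hS n).mono_f
    app_injective_of_mono (quotShortComplex (p ^ n) (godementShortComplex M)).f U
  have hmono : Mono ((godementShortComplex M).map (completion p)).f := by
    refine mono_of_app_injective _ fun U s t hst => completion_section_ext p M fun n => ?_
    refine hinj n U ?_
    exact (completionπ_app_map_app p (toGodement₀ M) n s).symm.trans
      ((congrArg _ hst).trans (completionπ_app_map_app p (toGodement₀ M) n t))
  refine { exact := ?_, mono_f := hmono, epi_g := ?_ }
  · refine exact_of_sections fun U s hs x hx => ?_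
    have h0 : ∀ n, ∃ a, (quotMap (le_refl (p ^ n)) (toGodement₀ M)).app U a =
        (completionπ p (godement₀ M) n).app U s := fun n => by
      have := (hS n).mono_f
      refine exists_app_eq (hS n).exact ((completionπ p (godement₀ M) n).app U s) ?_
      refine (completionπ_app_map_app p (cokernel.π (toGodement₀ M)) n s).symm.trans ?_
      exact (congrArg _ hs).trans (map_zero _)
    choose a ha using h0
    obtain ⟨t, ht⟩ := exists_completion_section p M a fun n => hinj n U (by
      rw [← transition_app_quotMap_app, ha, ha]
      exact transition_app_completionπ_app p (godement₀ M) n s)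
    refine ⟨U, le_rfl, hx, t, completion_section_ext p (godement₀ M) fun n => ?_⟩
    refine (completionπ_app_map_app p (toGodement₀ M) n t).trans ?_
    rw [ht, ha]
    exact congrArg _ (res_self _ s).symm
  · refine epi_of_locallySurjective _ fun V s x hx => ?_
    obtain ⟨U, hxU, hU⟩ := exists_affine_le hx
    let q : Γ((completion p).obj (cokernel (toGodement₀ M)), U.1) :=
      res ((completion p).obj (cokernel (toGodement₀ M))) hU s
    -- On an affine neighbourhood, lift the components of `q` one after another, compatibly.
    obtain ⟨g₀, hg₀⟩ : ∃ b, (quotMap (le_refl (p ^ 0)) (cokernel.π (toGodement₀ M))).app U.1 b =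
        (completionπ p _ 0).app U.1 q :=
      app_surjective_of_isAcyclicOn (hS 0) (hM U 0).2.1 _
    choose step hstep hstep' using fun (n : ℕ)
      (g : {g : Γ(quot (p ^ n) (godement₀ M), U.1) //
        (quotMap le_rfl (cokernel.π (toGodement₀ M))).app U.1 g =
          (completionπ p _ n).app U.1 q}) =>
      exists_transition_app_eq hp hM U n ((completionπ p _ (n + 1)).app U.1 q) g.1
        (g.2.trans (transition_app_completionπ_app p _ n q).symm)
    let G : ∀ n, {g : Γ(quot (p ^ n) (godement₀ M), U.1) //
        (quotMap le_rfl (cokernel.π (toGodement₀ M))).app U.1 g =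
          (completionπ p _ n).app U.1 q} :=
      Nat.rec ⟨g₀, hg₀⟩ (fun n g => ⟨step n g, hstep n g⟩)
    obtain ⟨t, ht⟩ := exists_completion_section p (godement₀ M) (fun n => (G n).1)
      (fun n => hstep' n (G n))
    refine ⟨U.1, hU, hxU, t, completion_section_ext p (cokernel (toGodement₀ M)) fun n => ?_⟩
    refine (completionπ_app_map_app p (cokernel.π (toGodement₀ M)) n t).trans ?_
    rw [ht]
    exact (G n).2

end AdicGodement

/-! ### The completed Godement resolution -/

namespace AdicGodement

variable {X : Scheme.{u}}

/-- Exactness is preserved by composing with an epimorphism on the left and with a monomorphism on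
the right. -/
theorem exact_splice {C : Type*} [Category* C] [Abelian C] {A B D E F : C} {a : A ⟶ B} {b : B ⟶ D}
    {c : D ⟶ E} {d : E ⟶ F} {w : b ≫ c = 0} (h : (ShortComplex.mk b c w).Exact)
    (_ : Epi a) (_ : Mono d) {f : A ⟶ D} {g : D ⟶ F} (hf : f = a ≫ b) (hg : g = c ≫ d)
    {w' : f ≫ g = 0} :
    (ShortComplex.mk f g w').Exact := by
  subst hf hg
  have w'' : (a ≫ b) ≫ c = 0 := by rw [Category.assoc, w, comp_zero]
  have h' : (ShortComplex.mk (a ≫ b) c w'').Exact :=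
    (ShortComplex.exact_iff_of_epi_of_isIso_of_mono
      ({ τ₁ := a, τ₂ := 𝟙 D, τ₃ := 𝟙 E } : ShortComplex.mk (a ≫ b) c w'' ⟶
        ShortComplex.mk b c w)).mpr
      h
  exact (ShortComplex.exact_iff_of_epi_of_isIso_of_mono
    ({ τ₁ := 𝟙 A, τ₂ := 𝟙 D, τ₃ := d } : ShortComplex.mk (a ≫ b) c w'' ⟶
      ShortComplex.mk (a ≫ b) (c ≫ d) w')).mp h'

theorem singleMap_comp_map_f_zero {C D : Type*} [Category* C] [Category* D] [HasZeroMorphisms C]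
    [HasZeroMorphisms D] [HasZeroObject C] [HasZeroObject D] (F : C ⥤ D)
    [F.PreservesZeroMorphisms] {N : C} {K : CochainComplex C ℕ}
    (ε : (CochainComplex.single₀ C).obj N ⟶ K) :
    ((HomologicalComplex.singleMapHomologicalComplex F (ComplexShape.up ℕ) 0).inv.app N ≫
      (F.mapHomologicalComplex (ComplexShape.up ℕ)).map ε).f 0 = F.map (ε.f 0) := by
  rw [HomologicalComplex.comp_f, Functor.mapHomologicalComplex_map_f,
    HomologicalComplex.singleMapHomologicalComplex_inv_app_self]
  have : (HomologicalComplex.singleObjXSelf (ComplexShape.up ℕ) 0 (F.obj N)).hom ≫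
      F.map (HomologicalComplex.singleObjXSelf (ComplexShape.up ℕ) 0 N).inv = 𝟙 (F.obj N) :=
    (Category.id_comp _).trans (F.map_id N)
  rw [this]
  exact Category.id_comp _

theorem kernel_godementComplex_d_iso (M : X.Modules) (i : ℕ) :
    Nonempty (godementCosyzygy M i ≅ kernel ((godementComplex M).d i (i + 1))) := by
  rw [godementComplex_d]
  let hk := (godementShortComplex_shortExact (godementCosyzygy M i)).fIsKernel
  have e : kernel (godementD M i) ≅ kernel (godementπ M i) := kernelCompMono _ _
  exact ⟨hk.conePointUniqueUpToIso (kernelIsKernel (godementπ M i)) ≪≫ e.symm⟩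

theorem completedGodementComplex_d (p : X.IdealSheafData) (M : X.Modules) (i : ℕ) :
    (completedGodementComplex p M).d i (i + 1) =
      (completion p).map (godementπ M i) ≫
        (completion p).map (toGodement₀ (godementCosyzygy M (i + 1))) := by
  rw [← Functor.map_comp]
  exact congrArg (completion p).map (godementComplex_d M i)

theorem godementAugmentation_f_zero (M : X.Modules) :
    (godementAugmentation M).f 0 = toGodement₀ M := by
  have h : toGodement₀ M ≫ (godementComplex M).d 0 1 = 0 := by
    rw [godementComplex_d M 0]
    exact toGodement₀_godementD M 0
  exact congrArg Subtype.val
    ((CochainComplex.fromSingle₀Equiv (godementComplex M) M).apply_symm_apply ⟨toGodement₀ M, h⟩)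

theorem completedGodementAugmentation_f_zero (p : X.IdealSheafData) (M : X.Modules) :
    (completedGodementAugmentation p M).f 0 = (completion p).map (toGodement₀ M) := by
  refine (singleMap_comp_map_f_zero (completion p) (godementAugmentation M)).trans ?_
  rw [godementAugmentation_f_zero]
  rfl

/-- A morphism from an object in degree zero to a complex is a quasi-isomorphism if the complex,
augmented by the object, is exact. -/
theorem quasiIso_of_exact {C : Type*} [Category* C] [Abelian C] {N : C} {K : CochainComplex C ℕ}
    (ε : (CochainComplex.single₀ C).obj N ⟶ K)
    (h₀ : (ShortComplex.mk (ε.f 0) (K.d 0 1) (by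
      rw [ε.comm 0 1, HomologicalComplex.single_obj_d, zero_comp])).Exact) [Mono (ε.f 0)]
    (h : ∀ i, (ShortComplex.mk (K.d i (i + 1)) (K.d (i + 1) (i + 2)) (K.d_comp_d _ _ _)).Exact) :
    QuasiIso ε := by
  rw [quasiIso_iff]
  rintro (_ | i)
  · rw [CochainComplex.quasiIsoAt₀_iff, ShortComplex.quasiIso_iff_of_zeros]
    · exact ⟨h₀, ‹Mono (ε.f 0)›⟩
    · exact HomologicalComplex.single_obj_d (ComplexShape.up ℕ) 0 N 0 0
    · exact HomologicalComplex.single_obj_d (ComplexShape.up ℕ) 0 N 0 1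
    · exact K.shape _ _ (by simp)
  · rw [quasiIsoAt_iff_exactAt _ _ (CochainComplex.exactAt_succ_single_obj _ _),
      HomologicalComplex.exactAt_iff' _ i (i + 1) (i + 2) (by simp) (by simp)]
    exact h i

/-- The completed Godement resolution of an affinely `p`-acyclic module is a flasque resolution. -/
theorem isFlasqueResolution_completedGodementAugmentation {p : X.IdealSheafData}
    (hp : ∀ U : X.affineOpens, (p.ideal U).FG) {M : X.Modules} (hM : IsAffinelyAcyclic p M) :
    IsFlasqueResolution (completedGodementAugmentation p M) where
  flasque i := isFlasque_completion_godement₀ hp (godementCosyzygy M i)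
  quasiIso := by
    have hS := fun i => completion_godementShortComplex_shortExact hp
      (isAffinelyAcyclic_godementCosyzygy hp hM i)
    have hmono : ∀ i, Mono ((completion p).map (toGodement₀ (godementCosyzygy M i))) :=
      fun i => (hS i).mono_f
    have hepi : ∀ i, Epi ((completion p).map (godementπ M i)) := fun i => (hS i).epi_g
    have h₀ := completedGodementAugmentation_f_zero p M
    have : Mono ((completedGodementAugmentation p M).f 0) := by
      rw [h₀]
      exact hmono 0
    refine quasiIso_of_exact _ ?_ fun i => ?_
    · exact exact_splice (a := 𝟙 _) (hS 0).exact inferInstance (hmono 1)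
        (h₀.trans (Category.id_comp _).symm)
        (completedGodementComplex_d p M 0)
    · exact exact_splice (hS (i + 1)).exact (hepi i) (hmono (i + 2))
        (completedGodementComplex_d p M i) (completedGodementComplex_d p M (i + 1))

end AdicGodement

/-! ### Sections of quasi-coherent modules over basic open sets -/

namespace AdicGodement

variable {X : Scheme.{u}}

/-- For every affine open `U` and `f ∈ Γ(U, 𝒪_X)`, the restriction `Γ(U, M) ⟶ Γ(D(f), M)` is
a localization away from `f`: sections over `D(f)` extend to `U` after multiplication by a power
of `f`, and sections over `U` vanishing on `D(f)` are killed by a power of `f`. -/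
structure HasLocalizedSections (M : X.Modules) : Prop where
  exists_res_eq : ∀ (U : X.affineOpens) (f : Γ(X, U.1)) (s : Γ(M, X.basicOpen f)),
    ∃ (n : ℕ) (t : Γ(M, U.1)), res M (X.basicOpen_le f) t =
      X.presheaf.map (homOfLE (X.basicOpen_le f)).op f ^ n • s
  exists_pow_smul_eq_zero : ∀ (U : X.affineOpens) (f : Γ(X, U.1)) (t : Γ(M, U.1)),
    res M (X.basicOpen_le f) t = 0 → ∃ n : ℕ, f ^ n • t = 0

theorem fromSpec_appIso_inv {U : X.Opens} (hU : IsAffineOpen U) (W : (Spec Γ(X, U)).Opens)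
    (h : hU.fromSpec ''ᵁ W ≤ U) (a : Γ(X, U)) :
    (hU.fromSpec.appIso W).inv ((Spec Γ(X, U)).presheaf.map W.leTop.op
      ((Scheme.ΓSpecIso Γ(X, U)).inv a)) = X.presheaf.map (homOfLE h).op a := by
  have key : (Scheme.ΓSpecIso Γ(X, U)).inv ≫ (Spec Γ(X, U)).presheaf.map W.leTop.op =
      X.presheaf.map (homOfLE h).op ≫ (hU.fromSpec.appIso W).hom := by
    rw [Scheme.Hom.appIso_hom', Scheme.Hom.map_appLE, Scheme.Hom.appLE, hU.fromSpec_app_self,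
      Category.assoc, ← Functor.map_comp]
    rfl
  have := CategoryTheory.congr_fun key a
  rw [ConcreteCategory.comp_apply, ConcreteCategory.comp_apply] at this
  rw [this, Iso.hom_inv_id_apply]

theorem hasLocalizedSections_of_isQuasicoherent (M : X.Modules) (hM : M.IsQuasicoherent) :
    HasLocalizedSections M := by
  suffices H : ∀ (U : X.affineOpens) (f : Γ(X, U.1)),
      (∀ s : Γ(M, X.basicOpen f), ∃ (n : ℕ) (t : Γ(M, U.1)), res M (X.basicOpen_le f) t =
        X.presheaf.map (homOfLE (X.basicOpen_le f)).op f ^ n • s) ∧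
      (∀ t : Γ(M, U.1), res M (X.basicOpen_le f) t = 0 → ∃ n : ℕ, f ^ n • t = 0) from
    ⟨fun U f => (H U f).1, fun U f => (H U f).2⟩
  intro U f
  let j := U.2.fromSpec
  have : IsOpenImmersion j := U.2.isOpenImmersion_fromSpec
  let N := M.restrict j
  have hN : N.IsQuasicoherent := inferInstanceAs ((M.restrict j).IsQuasicoherent)
  have hloc := (isIso_fromTildeΓ_iff_isLocalizing (M := N)).mp inferInstance f
  have h₀ : U.1 = j ''ᵁ ⊤ := by
    rw [Scheme.Hom.image_top_eq_opensRange, U.2.opensRange_fromSpec]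
  have h₁ : X.basicOpen f = j ''ᵁ PrimeSpectrum.basicOpen f := (U.2.fromSpec_image_basicOpen f).symm
  have smul_eq (W : (Spec Γ(X, U.1)).Opens) (h : j ''ᵁ W ≤ U.1) (a : Γ(X, U.1)) (x : Γ(N, W)) :
      (show Γ(M, j ''ᵁ W) from a • x) =
        X.presheaf.map (homOfLE h).op a • (show Γ(M, j ''ᵁ W) from x) := by
    rw [← fromSpec_appIso_inv U.2 W h a]
    rfl
  have aux (U' D' : X.Opens) (hU' : U' = j ''ᵁ ⊤) (hD' : D' = j ''ᵁ PrimeSpectrum.basicOpen f)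
      (hU : U' ≤ U.1) (hD : D' ≤ U') :
      (∀ s : Γ(M, D'), ∃ (n : ℕ) (t : Γ(M, U')), res M hD t =
        X.presheaf.map (homOfLE (hD.trans hU)).op f ^ n • s) ∧
      (∀ t : Γ(M, U'), res M hD t = 0 →
        ∃ n : ℕ, X.presheaf.map (homOfLE hU).op f ^ n • t = 0) := by
    subst hU' hD'
    constructor
    · intro s
      obtain ⟨⟨t, ⟨_, n, rfl⟩⟩, ht⟩ := hloc.surj s
      refine ⟨n, t, ?_⟩
      rw [← map_pow]
      exact ht.symm.trans (smul_eq _ _ (f ^ n) s)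
    · intro t ht
      obtain ⟨⟨_, n, rfl⟩, hn⟩ := (IsLocalizedModule.eq_zero_iff (.powers f)
        ((modulesSpecToSheaf.obj N).obj.map (PrimeSpectrum.basicOpen f).leTop.op).hom).mp ht
      refine ⟨n, ?_⟩
      rw [← map_pow]
      exact (smul_eq _ _ (f ^ n) t).symm.trans hn
  obtain ⟨a, b⟩ := aux U.1 (X.basicOpen f) h₀ h₁ le_rfl (X.basicOpen_le f)
  refine ⟨a, fun t ht => ?_⟩
  obtain ⟨n, hn⟩ := b t ht
  refine ⟨n, ?_⟩
  rwa [show X.presheaf.map (homOfLE (le_refl U.1)).op f = f from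
    CategoryTheory.congr_fun (X.presheaf.map_id (op U.1)) f] at hn

end AdicGodement

/-! ### Vanishing of cohomology on affine open sets -/

namespace AdicGodement

open AbSheaf

variable {X : Scheme.{u}}

namespace AbSheaf

/-- The restriction of a section of the abelian sheaf `F` to a smaller open set. -/
noncomputable abbrev rs (F : Sheaf (Opens.grothendieckTopology X) Ab.{u}) {U V : X.Opens}
    (h : V ≤ U) (s : F.obj.obj (op U)) : F.obj.obj (op V) :=
  F.obj.map (homOfLE h).op s

section

variable {F G : Sheaf (Opens.grothendieckTopology X) Ab.{u}} {U V W : X.Opens}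

theorem rs_rs (h : V ≤ U) (h' : W ≤ V) (s : F.obj.obj (op U)) :
    rs F h' (rs F h s) = rs F (h'.trans h) s := by
  rw [rs, rs, ← ConcreteCategory.comp_apply, ← Functor.map_comp]
  rfl

theorem rs_add (h : V ≤ U) (s t : F.obj.obj (op U)) : rs F h (s + t) = rs F h s + rs F h t :=
  map_add (F.obj.map (homOfLE h).op).hom s t

theorem rs_sub (h : V ≤ U) (s t : F.obj.obj (op U)) : rs F h (s - t) = rs F h s - rs F h t :=
  map_sub (F.obj.map (homOfLE h).op).hom s t

theorem app_rs (f : F ⟶ G) (h : V ≤ U) (s : F.obj.obj (op U)) :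
    f.hom.app (op V) (rs F h s) = rs G h (f.hom.app (op U) s) :=
  CategoryTheory.congr_fun (f.hom.naturality (homOfLE h).op) s

theorem exists_rs_eq_rs_eq (hV : V ≤ U) (hW : W ≤ U) (hU : U ≤ V ⊔ W) (a : F.obj.obj (op V))
    (b : F.obj.obj (op W)) (h : rs F (inf_le_left : V ⊓ W ≤ V) a = rs F inf_le_right b) :
    ∃ c : F.obj.obj (op U), rs F hV c = a ∧ rs F hW c = b := by
  let sf : ∀ i : Bool, F.obj.obj (op (bif i then V else W)) := fun
    | true => a
    | false => b
  obtain ⟨c, hc, -⟩ := TopCat.Sheaf.existsUnique_gluing' (F := F)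
    (fun i : Bool => bif i then V else W) U
    (fun i => homOfLE (show (bif i then V else W) ≤ U by cases i <;> assumption))
    (by rwa [iSup_bool_eq]) sf (by
      have h' : rs F (inf_le_left : W ⊓ V ≤ W) b = rs F inf_le_right a := by
        have := congrArg (rs F (inf_comm W V).le) h
        rw [rs_rs, rs_rs] at this
        exact this.symm
      rintro (_ | _) (_ | _)
      · rfl
      · exact h'
      · exact h
      · rfl)
  exact ⟨c, hc true, hc false⟩

end

variable (X) in
/-- The class of abelian sheaves `F` on `X` with vanishing first Čech cohomology for the coverings
of affine open sets `U` by two basic open sets `D(f)`, `D(g)` with `f + g = 1`. -/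
def HasSplitSections (F : Sheaf (Opens.grothendieckTopology X) Ab.{u}) : Prop :=
  ∀ (U : X.affineOpens) (f g : Γ(X, U.1)), f + g = 1 →
    ∀ s : F.obj.obj (op (X.basicOpen f ⊓ X.basicOpen g)),
      ∃ (a : F.obj.obj (op (X.basicOpen f))) (b : F.obj.obj (op (X.basicOpen g))),
        rs F inf_le_left a + rs F inf_le_right b = s

section ShortExact

variable {S : ShortComplex (Sheaf (Opens.grothendieckTopology X) Ab.{u})} (hS : S.ShortExact)
include hS

/-- Lifts of a section over `V` and `W` can be corrected to agree, provided that the sections of the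
kernel over `V ∩ W` split. -/
theorem exists_lift_of_le_sup {U V W : X.Opens} (hV : V ≤ U) (hW : W ≤ U) (hU : U ≤ V ⊔ W)
    (h₁ : ∀ s : S.X₁.obj.obj (op (V ⊓ W)), ∃ (a : S.X₁.obj.obj (op V)) (b : S.X₁.obj.obj (op W)),
      rs S.X₁ inf_le_left a + rs S.X₁ inf_le_right b = s)
    (q : S.X₃.obj.obj (op U)) {a : S.X₂.obj.obj (op V)} {b : S.X₂.obj.obj (op W)}
    (ha : S.g.hom.app (op V) a = rs S.X₃ hV q) (hb : S.g.hom.app (op W) b = rs S.X₃ hW q) :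
    ∃ t, S.g.hom.app (op U) t = q := by
  obtain ⟨c, hc⟩ : ∃ c, S.f.hom.app (op (V ⊓ W)) c =
      rs S.X₂ inf_le_left a - rs S.X₂ inf_le_right b := by
    refine TopCat.Sheaf.sections_exact_of_left_exact hS.1 hS.2 _ ?_
    rw [map_sub, app_rs, app_rs, ha, hb, rs_rs, rs_rs, sub_self]
  obtain ⟨c₁, c₂, rfl⟩ := h₁ c
  have hzero {V : X.Opens} (z : S.X₁.obj.obj (op V)) :
      S.g.hom.app (op V) (S.f.hom.app (op V) z) = 0 := by
    rw [← ConcreteCategory.comp_apply, ← NatTrans.comp_app,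
      ← ObjectProperty.FullSubcategory.comp_hom, S.zero]
    rfl
  rw [map_add, app_rs, app_rs] at hc
  obtain ⟨t, ht₁, ht₂⟩ := exists_rs_eq_rs_eq (F := S.X₂) hV hW hU
    (a - S.f.hom.app _ c₁) (b + S.f.hom.app _ c₂) (by
      rw [rs_sub, rs_add, sub_eq_iff_eq_add, add_assoc,
        add_comm (rs S.X₂ _ (S.f.hom.app _ c₂)), hc, add_sub_cancel])
  refine ⟨t, TopCat.Sheaf.eq_of_locally_eq₂ (F := S.X₃) (homOfLE hV) (homOfLE hW) hU _ _ ?_ ?_⟩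
  · exact (app_rs S.g hV t).symm.trans (by rw [ht₁, map_sub, hzero, ha, sub_zero])
  · exact (app_rs S.g hW t).symm.trans (by rw [ht₂, map_add, hzero, hb, add_zero])

/-- A section of the quotient which lifts over `D(f)` and `D(g)` lifts over `D(f + g)`. -/
theorem HasSplitSections.exists_lift_add (h₁ : HasSplitSections X S.X₁) {U : X.Opens}
    (hU : IsAffineOpen U) (q : S.X₃.obj.obj (op U)) {f g : Γ(X, U)}
    (hf : ∃ t, S.g.hom.app (op (X.basicOpen f)) t = rs S.X₃ (X.basicOpen_le f) q)
    (hg : ∃ t, S.g.hom.app (op (X.basicOpen g)) t = rs S.X₃ (X.basicOpen_le g) q) :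
    ∃ t, S.g.hom.app (op (X.basicOpen (f + g))) t = rs S.X₃ (X.basicOpen_le (f + g)) q := by
  obtain ⟨a, ha⟩ := hf
  obtain ⟨b, hb⟩ := hg
  -- On the affine open set `D(f + g)`, replace `f` and `g` by `f / (f + g)` and `g / (f + g)`.
  let ρ := (X.presheaf.map (homOfLE (X.basicOpen_le (f + g))).op).hom
  obtain ⟨v, hv⟩ : ∃ v : Γ(X, X.basicOpen (f + g)), v * (ρ f + ρ g) = 1 := by
    rw [← map_add]
    exact (RingedSpace.isUnit_res_basicOpen X.toRingedSpace (f + g)).exists_left_inv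
  have hD (r : Γ(X, U)) : X.basicOpen (v * ρ r) ≤ X.basicOpen r := by
    rw [Scheme.basicOpen_mul]
    refine inf_le_right.trans ?_
    change X.basicOpen (X.presheaf.map _ r) ≤ _
    rw [Scheme.basicOpen_res]
    exact inf_le_right
  have hsum : v * ρ f + v * ρ g = 1 := by rw [← mul_add, hv]
  have hcov : X.basicOpen (f + g) ≤ X.basicOpen (v * ρ f) ⊔ X.basicOpen (v * ρ g) := by
    refine le_trans (le_of_eq ?_) (X.basicOpen_add_le _ _)
    rw [hsum, Scheme.basicOpen_one]
  exact exists_lift_of_le_sup hS (X.basicOpen_le (v * ρ f)) (X.basicOpen_le (v * ρ g)) hcov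
    (h₁ ⟨_, hU.basicOpen (f + g)⟩ _ _ hsum) _
    (a := rs S.X₂ (hD f) a) (b := rs S.X₂ (hD g) b)
    (by rw [app_rs, ha, rs_rs, rs_rs]) (by rw [app_rs, hb, rs_rs, rs_rs])

/-- The functions `f` such that a given section of the quotient lifts over `D(f)` form an ideal,
which is contained in no prime ideal. -/
theorem HasSplitSections.app_surjective (h₁ : HasSplitSections X S.X₁) {U : X.Opens}
    (hU : IsAffineOpen U) : Function.Surjective (S.g.hom.app (op U)) := by
  intro q
  let I : Ideal Γ(X, U) :=
    { carrier := {f | ∃ t, S.g.hom.app (op (X.basicOpen f)) t = rs S.X₃ (X.basicOpen_le f) q}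
      add_mem' := fun hf hg => h₁.exists_lift_add hS hU q hf hg
      zero_mem' := ⟨0, TopCat.Sheaf.eq_of_locally_eq' (F := S.X₃) (fun i : PEmpty.{1} => i.elim) _
        (fun i => i.elim) (by rw [Scheme.basicOpen_zero]; exact bot_le) _ _ (fun i => i.elim)⟩
      smul_mem' := fun r f ⟨t, ht⟩ => by
        have hle : X.basicOpen (r • f) ≤ X.basicOpen f := by
          rw [smul_eq_mul, Scheme.basicOpen_mul]
          exact inf_le_right
        exact ⟨rs S.X₂ hle t, by rw [app_rs, ht, rs_rs]⟩ }
  suffices hI : I = ⊤ by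
    obtain ⟨t, ht⟩ : (1 : Γ(X, U)) ∈ I := hI ▸ Submodule.mem_top
    refine ⟨rs S.X₂ (Scheme.basicOpen_one (X := X) (U := U)).ge t, ?_⟩
    rw [app_rs, ht, rs_rs]
    exact CategoryTheory.congr_fun (S.X₃.obj.map_id (op U)) q
  rw [← Ideal.span_eq I, ← hU.self_le_iSup_basicOpen_iff]
  intro x hx
  have := (TopCat.Sheaf.isLocallySurjective_iff_epi S.g).mpr hS.epi_g
  obtain ⟨V, hV, ⟨t, ht⟩, hxV⟩ :=
    (TopCat.Presheaf.isLocallySurjective_iff S.g.hom).mp this U q x hx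
  obtain ⟨f, hf, hxf⟩ := hU.exists_basicOpen_le ⟨x, hxV⟩ hx
  refine Opens.mem_iSup.mpr ⟨⟨f, rs S.X₂ hf t, ?_⟩, hxf⟩
  rw [app_rs, ht]
  exact rs_rs _ _ _

theorem HasSplitSections.of_shortExact (h₁ : HasSplitSections X S.X₁)
    (h₂ : HasSplitSections X S.X₂) : HasSplitSections X S.X₃ := by
  intro U f g hfg s
  have hD : IsAffineOpen (X.basicOpen f ⊓ X.basicOpen g) := by
    rw [← Scheme.basicOpen_mul]
    exact U.2.basicOpen _
  obtain ⟨t, rfl⟩ := h₁.app_surjective hS hD s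
  obtain ⟨a, b, rfl⟩ := h₂ U f g hfg t
  exact ⟨S.g.hom.app _ a, S.g.hom.app _ b, by rw [map_add, app_rs, app_rs]⟩

end ShortExact

theorem hasSplitSections_of_isFlasque (F : Sheaf (Opens.grothendieckTopology X) Ab.{u})
    (hF : TopCat.Sheaf.IsFlasque F) : HasSplitSections X F := by
  intro U f g _ s
  obtain ⟨a, ha⟩ := (AddCommGrpCat.epi_iff_surjective _).mp
    (hF.epi (homOfLE (inf_le_left : X.basicOpen f ⊓ X.basicOpen g ≤ X.basicOpen f)).op) s
  exact ⟨a, 0, (congrArg₂ _ ha (map_zero _)).trans (add_zero s)⟩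

theorem HasSplitSections.isAcyclic {F : Sheaf (Opens.grothendieckTopology X) Ab.{u}}
    (hF : HasSplitSections X F) {U : X.Opens} (hU : IsAffineOpen U) : IsAcyclic F U :=
  isAcyclic_of_forall_shortExact (HasSplitSections X) (fun U : X.Opens => IsAffineOpen U)
    (fun _ hS h₂ h₁ => ⟨h₁.of_shortExact hS (hasSplitSections_of_isFlasque _ h₂),
      fun _ hU => h₁.app_surjective hS hU⟩) hF hU

end AbSheaf

end AdicGodement

/-! ### Quasi-coherent modules are affinely acyclic -/

namespace AdicGodement

open AbSheaf

variable {X : Scheme.{u}}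

theorem presheaf_map_map {U V W : X.Opens} (h : V ≤ U) (h' : W ≤ V) (r : Γ(X, U)) :
    X.presheaf.map (homOfLE h').op (X.presheaf.map (homOfLE h).op r) =
      X.presheaf.map (homOfLE (h'.trans h)).op r := by
  rw [← ConcreteCategory.comp_apply, ← Functor.map_comp]
  rfl

theorem exists_mul_map_basicOpen_eq_one {U : X.Opens} (f : Γ(X, U)) :
    ∃ r : Γ(X, X.basicOpen f), r * X.presheaf.map (homOfLE (X.basicOpen_le f)).op f = 1 :=
  (RingedSpace.isUnit_res_basicOpen X.toRingedSpace f).exists_left_inv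

/-- A power of `f` is cleared from the denominator over `D(f)`. -/
theorem exists_res_eq_of_res_eq_pow_smul {M : X.Modules} {U : X.Opens} {f : Γ(X, U)}
    {D : X.Opens} (hD : D ≤ X.basicOpen f) (s : Γ(M, D)) (n : ℕ) (t : Γ(M, U))
    (ht : res M (hD.trans (X.basicOpen_le f)) t =
      X.presheaf.map (homOfLE (hD.trans (X.basicOpen_le f))).op f ^ n • s) :
    ∃ a : Γ(M, X.basicOpen f), res M hD a = s := by
  obtain ⟨r, hr⟩ := exists_mul_map_basicOpen_eq_one f
  refine ⟨r ^ n • res M (X.basicOpen_le f) t, ?_⟩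
  rw [res_smul, res_res, ht, map_pow, smul_smul, ← mul_pow,
    ← presheaf_map_map (X.basicOpen_le f) hD, ← map_mul, hr, map_one, one_pow, one_smul]

theorem HasLocalizedSections.hasSplitSections {M : X.Modules} (hM : HasLocalizedSections M) :
    HasSplitSections X ((toSheaf X).obj M) := by
  intro U f g hfg s
  change Γ(M, X.basicOpen f ⊓ X.basicOpen g) at s
  have hD : X.basicOpen (f * g) = X.basicOpen f ⊓ X.basicOpen g := X.basicOpen_mul f g
  have hU : X.basicOpen f ⊓ X.basicOpen g ≤ U.1 := inf_le_left.trans (X.basicOpen_le f)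
  obtain ⟨n, t, ht⟩ := hM.exists_res_eq U (f * g) (res M hD.le s)
  replace ht := congrArg (res M hD.ge) ht
  rw [res_res, res_smul, res_res, res_self, map_pow, presheaf_map_map, map_mul, mul_pow] at ht
  -- Since `u fⁿ + v gⁿ = 1` for some `u` and `v`, the section `s` is the sum of `v gⁿ s`, which
  -- extends to `D(f)`, and `u fⁿ s`, which extends to `D(g)`.
  obtain ⟨u, v, huv⟩ : IsCoprime (f ^ n) (g ^ n) :=
    IsCoprime.pow ⟨1, 1, by rwa [one_mul, one_mul]⟩
  let ρ := (X.presheaf.map (homOfLE hU).op).hom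
  change res M hU t = (ρ f ^ n * ρ g ^ n) • s at ht
  obtain ⟨a, ha⟩ := exists_res_eq_of_res_eq_pow_smul (f := f) inf_le_left ((ρ v * ρ g ^ n) • s) n
    (v • t) (by
      rw [res_smul]
      change ρ v • res M hU t = ρ f ^ n • _
      rw [ht, smul_smul, smul_smul]
      ring_nf)
  obtain ⟨b, hb⟩ := exists_res_eq_of_res_eq_pow_smul (f := g) inf_le_right ((ρ u * ρ f ^ n) • s) n
    (u • t) (by
      rw [res_smul]
      change ρ u • res M hU t = ρ g ^ n • _
      rw [ht, smul_smul, smul_smul]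
      ring_nf)
  have hs : (ρ v * ρ g ^ n) • s + (ρ u * ρ f ^ n) • s = s := by
    rw [← add_smul, ← map_pow, ← map_pow, ← map_mul, ← map_mul, ← map_add, add_comm, huv, map_one,
      one_smul]
  exact ⟨a, b, (congrArg₂ _ ha hb).trans hs⟩

/-- Sections of `I · Γ(D(f), M)` extend to sections of `I · Γ(U, M)` after multiplication by a power
of `f`. -/
theorem HasLocalizedSections.exists_mem_smul_top {M : X.Modules} (hM : HasLocalizedSections M)
    (U : X.affineOpens) (I : Ideal Γ(X, U.1)) (f : Γ(X, U.1)) (s : Γ(M, X.basicOpen f))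
    (hs : s ∈ (I.map (X.presheaf.map (homOfLE (X.basicOpen_le f)).op).hom • ⊤ :
      Submodule Γ(X, X.basicOpen f) Γ(M, X.basicOpen f))) :
    ∃ (n : ℕ), ∃ t ∈ (I • ⊤ : Submodule Γ(X, U.1) Γ(M, U.1)),
      res M (X.basicOpen_le f) t = X.presheaf.map (homOfLE (X.basicOpen_le f)).op f ^ n • s := by
  let ρ := (X.presheaf.map (homOfLE (X.basicOpen_le f)).op).hom
  change ∃ n, ∃ t ∈ _, res M (X.basicOpen_le f) t = ρ f ^ n • s
  induction hs using Submodule.smul_induction_on' with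
  | smul r hr m _ =>
    have := U.2.isLocalization_basicOpen f
    obtain ⟨⟨⟨i, hi⟩, ⟨_, k, rfl⟩⟩, h⟩ :=
      (IsLocalization.mem_map_algebraMap_iff (Submonoid.powers f) _).mp hr
    replace h : r * ρ (f ^ k) = ρ i := h
    obtain ⟨n, t, ht⟩ := hM.exists_res_eq U f m
    refine ⟨k + n, i • t, Submodule.smul_mem_smul hi trivial, ?_⟩
    rw [res_smul, ht]
    change ρ i • ρ f ^ n • m = _
    rw [← h, smul_smul, smul_smul, map_pow]
    ring_nf
  | add a _ b _ ha hb =>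
    obtain ⟨n, t, ht, ht'⟩ := ha
    obtain ⟨n', t', h, h'⟩ := hb
    refine ⟨n + n', f ^ n' • t + f ^ n • t', add_mem (Submodule.smul_mem _ _ ht)
      (Submodule.smul_mem _ _ h), ?_⟩
    rw [res_add, res_smul, res_smul, ht', h']
    change ρ (f ^ n') • ρ f ^ n • a + ρ (f ^ n) • ρ f ^ n' • b = _
    rw [smul_smul, smul_smul, map_pow, map_pow, smul_add]
    ring_nf

/-- The functions `f` with `f s ∈ J(U) Γ(U, M)` form an ideal, and for a section `s` of `J M` its
radical is contained in no prime ideal. -/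
theorem HasLocalizedSections.mem_smul_top {M : X.Modules} (hM : HasLocalizedSections M)
    (J : X.IdealSheafData) (U : X.affineOpens) (s : Γ(M, U.1)) (hs : IsSectionOfMul J M s) :
    s ∈ (J.ideal U • ⊤ : Submodule Γ(X, U.1) Γ(M, U.1)) := by
  let I : Ideal Γ(X, U.1) :=
    (J.ideal U • ⊤ : Submodule Γ(X, U.1) Γ(M, U.1)).comap (LinearMap.toSpanSingleton _ _ s)
  have hI (f : Γ(X, U.1)) : f ∈ I ↔ f • s ∈ (J.ideal U • ⊤ : Submodule Γ(X, U.1) Γ(M, U.1)) :=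
    Iff.rfl
  suffices h : I.radical = ⊤ by
    rw [Ideal.radical_eq_top] at h
    simpa using (hI 1).mp (h ▸ Submodule.mem_top)
  rw [← Ideal.span_eq I.radical, ← U.2.self_le_iSup_basicOpen_iff]
  intro x hx
  obtain ⟨V, hV, hxV, h⟩ := hs x hx
  obtain ⟨f, hf, hxf⟩ := U.2.exists_basicOpen_le ⟨x, hxV⟩ hx
  refine Opens.mem_iSup.mpr ⟨⟨f, ?_⟩, hxf⟩
  have h' : res M (hf.trans hV) s ∈ (J.ideal (X.affineBasicOpen f) • ⊤ :
      Submodule Γ(X, (X.affineBasicOpen f).1) Γ(M, (X.affineBasicOpen f).1)) := by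
    rw [← res_res M hV hf]
    exact map_mem_smul_top J M (W := X.affineBasicOpen f) hf h
  obtain ⟨n, t, ht, htn⟩ := hM.exists_mem_smul_top U (J.ideal U) f _
    (J.map_ideal_basicOpen U f ▸ h')
  obtain ⟨k, hk⟩ := hM.exists_pow_smul_eq_zero U f (f ^ n • s - t) (by
    rw [res_sub, res_smul, htn, map_pow]
    exact sub_self _)
  refine ⟨k + n, (hI _).mpr ?_⟩
  rw [smul_sub, sub_eq_zero, smul_smul, ← pow_add] at hk
  rw [hk]
  exact Submodule.smul_mem _ _ ht

theorem HasLocalizedSections.mul {M : X.Modules} (hM : HasLocalizedSections M)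
    (J : X.IdealSheafData) : HasLocalizedSections (mul J M) where
  exists_res_eq U f s := by
    obtain ⟨n, t, ht, h⟩ := hM.exists_mem_smul_top U (J.ideal U) f s.1
      (J.map_ideal_basicOpen U f ▸ hM.mem_smul_top J (X.affineBasicOpen f) s.1 s.2)
    exact ⟨n, ⟨t, isSectionOfMul_of_mem_smul_top ht⟩, Subtype.ext h⟩
  exists_pow_smul_eq_zero U f t ht := by
    obtain ⟨n, hn⟩ := hM.exists_pow_smul_eq_zero U f t.1 (congrArg Subtype.val ht)
    exact ⟨n, Subtype.ext hn⟩

theorem isAffinelyAcyclic_of_isQuasicoherent (p : X.IdealSheafData) (M : X.Modules)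
    (hM : M.IsQuasicoherent) : IsAffinelyAcyclic p M := by
  intro U n
  have h := hasLocalizedSections_of_isQuasicoherent M hM
  have hS := shortExact_toSheaf (mul_shortExact (p ^ n) M)
  have hmul := (h.mul (p ^ n)).hasSplitSections
  refine ⟨h.hasSplitSections.isAcyclic U.2,
    (hmul.of_shortExact hS h.hasSplitSections).isAcyclic U.2, ?_⟩
  rw [tensorToSections_bijective_iff]
  exact ⟨hmul.app_surjective hS U.2, h.mem_smul_top (p ^ n) U⟩

end AdicGodement

theorem mainTheorem2 (X : Scheme.{u}) (p : X.IdealSheafData)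
    (hp : ∀ U : X.affineOpens, (p.ideal U).FG) :
    (∀ M : X.Modules, M.IsQuasicoherent → AdicGodement.IsAffinelyAcyclic p M) ∧
    ∀ M : X.Modules, AdicGodement.IsAffinelyAcyclic p M →
      AdicGodement.IsFlasqueResolution (AdicGodement.completedGodementAugmentation p M) ∧
      ∀ i : ℕ, AdicGodement.IsAffinelyAcyclic p
        (kernel ((AdicGodement.godementComplex M).d i (i + 1))) := by
  refine ⟨AdicGodement.isAffinelyAcyclic_of_isQuasicoherent p, fun M hM => ⟨
    AdicGodement.isFlasqueResolution_completedGodementAugmentation hp hM, fun i => ?_⟩⟩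
  obtain ⟨e⟩ := AdicGodement.kernel_godementComplex_d_iso M i
  exact AdicGodement.isAffinelyAcyclic_of_iso p e
    (AdicGodement.isAffinelyAcyclic_godementCosyzygy hp hM i)
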